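/- Let $M$ be a smooth manifold of even dimension $n$ with a smooth connection $\nabla$ in $TM$, with torsion $T(X,Y)=\nabla_XY-\nabla_YX-[X,Y]$. Let $\pi:J(M)\to M$ be the bundle whose fibre over $x$ is the set of all $j\in\operatorname{End}(T_xM)$ with $j^2=-1$, and let $\mathcal J$ be the tautological section of $\pi^*\operatorname{End}(TM)$, $\mathcal J_j=j$. The connection determines an almost complex structure $J^\nabla$ on the manifold $J(M)$ by $$d\pi(J^\nabla X)=\mathcal J\,d\pi(X),\qquad (\pi^*\nabla)_{J^\nabla X}\mathcal J=\mathcal J\,(\pi^*\nabla)_X\mathcal J$$ for all tangent vectors $X$ to $J(M)$. Suppose that $J^\nabla$ is integrable, i.e. that its Nijenhuis tensor vanishes. Then there is a smooth torsion-free connection $\nabla'$ in $TM$ with $J^{\nabla'}=J^\nabla$. More precisely, the torsion of $\nabla$ is of trace type, $$T(X,Y)=\alpha(X)Y-\alpha(Y)X,\qquad \alpha(X)=\frac1{n-1}\operatorname{tr}\bigl(Y\mapsto T(X,Y)\bigr),$$ and one may take $$\nabla'_XY=\nabla_XY-\tfrac12T(X,Y)=\nabla_XY-\tfrac12\bigl(\alpha(X)Y-\alpha(Y)X\bigr).$$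 -/

import Mathlib

open Bundle Set
open scoped Manifold ContDiff Topology

noncomputable section

set_option linter.unusedSectionVars false

namespace Twistor

section Cayley

variable {R : Type*} [Ring R] [Algebra ℝ R]

/-- The Cayley transform centred at `j₀`. -/
def cay (j₀ j : R) : R := (j - j₀) * Ring.inverse (j + j₀)

/-- The inverse Cayley transform. -/
def icay (j₀ a : R) : R := (1 + a) * j₀ * Ring.inverse (1 + a)

theorem cay_anti {j₀ j : R} (h₀ : j₀ * j₀ = -1) (h : j * j = -1) (hu : IsUnit (j + j₀)) :
    cay j₀ j * j₀ = -(j₀ * cay j₀ j) := by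
  obtain ⟨u, hu⟩ := hu
  have e1 : j₀ * (j + j₀) = (j + j₀) * j := by
    rw [mul_add, add_mul, h, h₀]; abel
  have e2 : (j - j₀) * j = -(j₀ * (j - j₀)) := by
    rw [mul_sub, sub_mul, h, h₀]; abel
  rw [← hu] at e1
  have e3 : (↑u⁻¹ : R) * j₀ = j * ↑u⁻¹ := by
    rw [Units.inv_mul_eq_iff_eq_mul, ← mul_assoc, ← e1, mul_assoc, Units.mul_inv, mul_one]
  rw [cay, ← hu, Ring.inverse_unit, mul_assoc, e3, ← mul_assoc, e2, neg_mul, mul_assoc]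

theorem one_add_cay {j₀ j : R} (hu : IsUnit (j + j₀)) :
    1 + cay j₀ j = (2 : ℝ) • j * Ring.inverse (j + j₀) := by
  have : (1 : R) = (j + j₀) * Ring.inverse (j + j₀) := (Ring.mul_inverse_cancel _ hu).symm
  rw [cay]
  nth_rw 1 [this]
  rw [← add_mul, two_smul]
  congr 1
  abel

theorem isUnit_of_sq {j : R} (h : j * j = -1) : IsUnit j :=
  ⟨⟨j, -j, by rw [mul_neg, h, neg_neg], by rw [neg_mul, h, neg_neg]⟩, rfl⟩

theorem isUnit_one_add_cay {j₀ j : R} (h : j * j = -1) (hu : IsUnit (j + j₀)) :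
    IsUnit (1 + cay j₀ j) := by
  rw [one_add_cay hu]
  refine IsUnit.mul ?_ hu.ringInverse
  have := (isUnit_of_sq h)
  rw [Algebra.smul_def]
  exact ((isUnit_iff_ne_zero.2 (two_ne_zero)).map _).mul this

theorem icay_cay {j₀ j : R} (h₀ : j₀ * j₀ = -1) (h : j * j = -1) (hu : IsUnit (j + j₀)) :
    icay j₀ (cay j₀ j) = j := by
  have hv := isUnit_one_add_cay h hu
  suffices (1 + cay j₀ j) * j₀ = j * (1 + cay j₀ j) by
    rw [icay, this, mul_assoc, Ring.mul_inverse_cancel _ hv, mul_one]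
  rw [one_add_cay hu]
  obtain ⟨u, hu⟩ := hu
  have e1 : j₀ * (j + j₀) = (j + j₀) * j := by
    rw [mul_add, add_mul, h, h₀]; abel
  rw [← hu] at e1
  have e3 : (↑u⁻¹ : R) * j₀ = j * ↑u⁻¹ := by
    rw [Units.inv_mul_eq_iff_eq_mul, ← mul_assoc, ← e1, mul_assoc, Units.mul_inv, mul_one]
  rw [← hu, Ring.inverse_unit, mul_assoc, e3]
  simp only [smul_mul_assoc, mul_smul_comm]

theorem icay_sq {j₀ a : R} (h₀ : j₀ * j₀ = -1) (hu : IsUnit (1 + a)) :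
    icay j₀ a * icay j₀ a = -1 := by
  obtain ⟨u, hu⟩ := hu
  rw [icay, ← hu, Ring.inverse_unit]
  calc (u : R) * j₀ * ↑u⁻¹ * (u * j₀ * ↑u⁻¹) = u * (j₀ * (↑u⁻¹ * u) * j₀) * ↑u⁻¹ := by
        simp only [mul_assoc]
    _ = -1 := by simp [h₀]

theorem isUnit_one_sub {j₀ a : R} (h₀ : j₀ * j₀ = -1) (ha : a * j₀ = -(j₀ * a))
    (hu : IsUnit (1 + a)) : IsUnit (1 - a) := by
  have hj := isUnit_of_sq h₀
  have : (1 - a) = -(j₀ * (1 + a) * j₀) := by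
    rw [mul_assoc, add_mul, ha, mul_add, one_mul, h₀, mul_neg, ← mul_assoc, h₀]
    simp only [mul_one, neg_mul, one_mul]; abel
  rw [this]
  exact ((hj.mul hu).mul hj).neg

theorem icay_add {j₀ a : R} (h₀ : j₀ * j₀ = -1) (ha : a * j₀ = -(j₀ * a))
    (hu : IsUnit (1 + a)) : icay j₀ a + j₀ = (2 : ℝ) • j₀ * Ring.inverse (1 + a) := by
  have : j₀ = j₀ * (1 + a) * Ring.inverse (1 + a) := by
    rw [mul_assoc, Ring.mul_inverse_cancel _ hu, mul_one]
  rw [icay]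
  nth_rw 2 [this]
  rw [← add_mul, add_mul 1 a, mul_add, ha, two_smul]
  congr 1
  simp only [one_mul, mul_one]; abel

theorem isUnit_icay_add {j₀ a : R} (h₀ : j₀ * j₀ = -1) (ha : a * j₀ = -(j₀ * a))
    (hu : IsUnit (1 + a)) : IsUnit (icay j₀ a + j₀) := by
  rw [icay_add h₀ ha hu]
  refine IsUnit.mul ?_ hu.ringInverse
  rw [Algebra.smul_def]
  exact ((isUnit_iff_ne_zero.2 (two_ne_zero)).map _).mul (isUnit_of_sq h₀)

theorem cay_icay {j₀ a : R} (h₀ : j₀ * j₀ = -1) (ha : a * j₀ = -(j₀ * a))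
    (hu : IsUnit (1 + a)) : cay j₀ (icay j₀ a) = a := by
  have hv := isUnit_icay_add h₀ ha hu
  suffices icay j₀ a - j₀ = a * (icay j₀ a + j₀) by
    rw [cay, this, mul_assoc, Ring.mul_inverse_cancel _ hv, mul_one]
  have e : icay j₀ a - j₀ = (2 : ℝ) • (a * j₀) * Ring.inverse (1 + a) := by
    have : j₀ = j₀ * (1 + a) * Ring.inverse (1 + a) := by
      rw [mul_assoc, Ring.mul_inverse_cancel _ hu, mul_one]
    rw [icay]
    nth_rw 2 [this]
    rw [← sub_mul, add_mul 1 a, mul_add, smul_mul_assoc]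
    simp only [one_mul, mul_one, ha, two_smul, ← add_mul]
    congr 1
    abel
  rw [e, icay_add h₀ ha hu]
  simp only [smul_mul_assoc, mul_smul_comm, mul_assoc]

end Cayley

section Conj
variable {E : Type*} [NormedAddCommGroup E] [NormedSpace ℝ E] [FiniteDimensional ℝ E]

theorem exists_conj {j k : E →L[ℝ] E} (hj : j * j = -1) (hk : k * k = -1) :
    ∃ g : (E →L[ℝ] E)ˣ, k = g * j * ↑g⁻¹ := by
  have key : ∀ j : E →L[ℝ] E, j * j = -1 → ∃ e : E ≃ₗ[ℝ] (Fin (Module.finrank ℝ E / 2) → ℂ),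
      ∀ v, e (j v) = Complex.I • e v := by
    intro j hj
    have hj' : j.toLinearMap * j.toLinearMap = (-1 : Module.End ℝ E) := by
      ext v; exact congr($hj v)
    let φ : ℂ →ₐ[ℝ] Module.End ℝ E := Complex.lift ⟨j.toLinearMap, hj'⟩
    let : Module ℂ E := Module.compHom E φ.toRingHom
    have hsm : ∀ (z : ℂ) (v : E), z • v = φ z v := fun z v => rfl
    have : IsScalarTower ℝ ℂ E := ⟨fun r z v => by rw [hsm, hsm, map_smul]; rfl⟩
    have : FiniteDimensional ℂ E := Module.Finite.of_restrictScalars_finite ℝ ℂ E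
    have hd : Module.finrank ℂ E = Module.finrank ℝ E / 2 := by
      have := Module.finrank_mul_finrank ℝ ℂ E
      rw [Complex.finrank_real_complex] at this
      omega
    let e : E ≃ₗ[ℂ] (Fin (Module.finrank ℝ E / 2) → ℂ) :=
      LinearEquiv.ofFinrankEq _ _ (by simp [hd])
    refine ⟨e.restrictScalars ℝ, fun v => ?_⟩
    have : j v = Complex.I • v := by
      rw [hsm]; simp [φ]
    simp only [LinearEquiv.restrictScalars_apply]
    rw [this, map_smul]
  obtain ⟨e, he⟩ := key j hj
  obtain ⟨f, hf⟩ := key k hk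
  let G : E ≃L[ℝ] E := (e.trans f.symm).toContinuousLinearEquiv
  have hG : ∀ v, G v = f.symm (e v) := fun v => rfl
  refine ⟨(ContinuousLinearEquiv.unitsEquiv ℝ E).symm G, ?_⟩
  rw [Units.eq_mul_inv_iff_mul_eq]
  ext v
  change k (G v) = G (j v)
  rw [hG, hG, he]
  apply f.injective
  rw [hf]; simp

end Conj
end Twistor

namespace Twistor

section Defs
variable (E : Type*) [NormedAddCommGroup E] [NormedSpace ℝ E]
  (M : Type*) [TopologicalSpace M] [ChartedSpace E M]

/-- The twistor space `J(M)`: pairs of a point `x` of `M` and an endomorphism `j` of `T_x M`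
with `j² = -1`. -/
structure TwistorSpace where
  /-- The base point. -/
  pt : M
  /-- The complex structure on the tangent space at the base point. -/
  str : TangentSpace 𝓘(ℝ, E) pt →L[ℝ] TangentSpace 𝓘(ℝ, E) pt
  sq : ∀ v, str (str v) = -v

open Classical in
/-- A fixed reference complex structure on the model space (`0` if there is none). -/
def stdJ : E →L[ℝ] E :=
  if h : ∃ j : E →L[ℝ] E, j * j = -1 then h.choose else 0

variable {E} in
theorem stdJ_sq {j : E →L[ℝ] E} (hj : j * j = -1) : stdJ E * stdJ E = -1 := by
  have h : ∃ j : E →L[ℝ] E, j * j = -1 := ⟨j, hj⟩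
  rw [stdJ, dif_pos h]
  exact h.choose_spec

/-- The endomorphisms of the model space that anticommute with the reference structure. -/
def antiEnd : Submodule ℝ (E →L[ℝ] E) where
  carrier := {a | a * stdJ E = -(stdJ E * a)}
  add_mem' {a b} ha hb := by
    simp only [Set.mem_ofPred_eq] at *
    rw [add_mul, mul_add, ha, hb, neg_add]
  zero_mem' := by simp
  smul_mem' c a ha := by
    simp only [Set.mem_ofPred_eq] at *
    rw [smul_mul_assoc, mul_smul_comm, ha, smul_neg]

variable {E} in
theorem mem_antiEnd {a : E →L[ℝ] E} : a ∈ antiEnd E ↔ a * stdJ E = -(stdJ E * a) := Iff.rfl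

/-- The vector space on which `J(M)` is modelled. -/
abbrev TwistorModel := E × antiEnd E

open Classical in
/-- A linear projection of `End E` onto `antiEnd E` (`0` if there is no complex structure). -/
def antiProj : (E →L[ℝ] E) →L[ℝ] antiEnd E :=
  if h : stdJ E * stdJ E = -1 then
    ContinuousLinearMap.codRestrict
      ((2⁻¹ : ℝ) • (ContinuousLinearMap.id ℝ (E →L[ℝ] E) +
        (ContinuousLinearMap.mul ℝ (E →L[ℝ] E) (stdJ E)).comp
          ((ContinuousLinearMap.mul ℝ (E →L[ℝ] E)).flip (stdJ E)))) (antiEnd E) (by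
        intro a
        rw [mem_antiEnd]
        simp only [smul_apply, add_apply,
          ContinuousLinearMap.comp_apply, ContinuousLinearMap.id_apply,
          ContinuousLinearMap.flip_apply, ContinuousLinearMap.mul_apply']
        rw [smul_mul_assoc, mul_smul_comm, ← smul_neg, add_mul, mul_add, neg_add, ← mul_assoc,
          ← mul_assoc, mul_assoc (stdJ E * a), ← mul_assoc (stdJ E) (stdJ E), h]
        simp only [mul_neg, neg_mul, mul_one, one_mul, neg_neg]
        rw [add_comm])
  else 0

variable {E} in
theorem antiProj_coe (h : stdJ E * stdJ E = -1) {a : E →L[ℝ] E} (ha : a ∈ antiEnd E) :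
    (antiProj E a : E →L[ℝ] E) = a := by
  rw [antiProj, dif_pos h]
  simp only [ContinuousLinearMap.coe_codRestrict_apply,
    smul_apply, add_apply,
    ContinuousLinearMap.comp_apply, ContinuousLinearMap.id_apply,
    ContinuousLinearMap.flip_apply, ContinuousLinearMap.mul_apply']
  rw [mem_antiEnd.1 ha, mul_neg, ← mul_assoc, h, neg_mul, neg_neg, one_mul, ← two_smul ℝ,
    smul_smul]
  norm_num

end Defs

section Charts
variable {E : Type*} [NormedAddCommGroup E] [NormedSpace ℝ E]
  {M : Type*} [TopologicalSpace M] [ChartedSpace E M] [IsManifold 𝓘(ℝ, E) ∞ M]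

/-- The endomorphism `k` of `T_x M`, read in the coordinates of the preferred chart at `x₀`. -/
def toCoord (x₀ x : M) (k : E →L[ℝ] E) : E →L[ℝ] E :=
  tangentCoordChange 𝓘(ℝ, E) x x₀ x * k * tangentCoordChange 𝓘(ℝ, E) x₀ x x

/-- The endomorphism of `T_x M` whose expression in the preferred chart at `x₀` is `k`. -/
def ofCoord (x₀ x : M) (k : E →L[ℝ] E) : E →L[ℝ] E :=
  tangentCoordChange 𝓘(ℝ, E) x₀ x x * k * tangentCoordChange 𝓘(ℝ, E) x x₀ x

theorem tcc_mul {w x y z : M} (hw : z ∈ (chartAt E w).source) (hx : z ∈ (chartAt E x).source)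
    (hy : z ∈ (chartAt E y).source) :
    tangentCoordChange 𝓘(ℝ, E) x y z * tangentCoordChange 𝓘(ℝ, E) w x z =
      tangentCoordChange 𝓘(ℝ, E) w y z := by
  ext v
  exact tangentCoordChange_comp (by simp [hw, hx, hy])

theorem tcc_self {x z : M} (hx : z ∈ (chartAt E x).source) :
    tangentCoordChange 𝓘(ℝ, E) x x z = 1 := by
  ext v
  exact tangentCoordChange_self (by simp [hx])

theorem ofCoord_eq_toCoord (x₀ x : M) (k : E →L[ℝ] E) :
    ofCoord x₀ x k = tangentCoordChange 𝓘(ℝ, E) x₀ x x * k * tangentCoordChange 𝓘(ℝ, E) x x₀ x :=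
  rfl

theorem toCoord_ofCoord {x₀ x₁ x : M} (h₀ : x ∈ (chartAt E x₀).source)
    (h₁ : x ∈ (chartAt E x₁).source) (k : E →L[ℝ] E) :
    toCoord x₁ x (ofCoord x₀ x k) =
      tangentCoordChange 𝓘(ℝ, E) x₀ x₁ x * k * tangentCoordChange 𝓘(ℝ, E) x₁ x₀ x := by
  have hx := mem_chart_source E x
  rw [toCoord, ofCoord, ← tcc_mul h₀ hx h₁, ← tcc_mul h₁ hx h₀]
  simp only [mul_assoc]

theorem toCoord_ofCoord_self {x₀ x : M} (h₀ : x ∈ (chartAt E x₀).source) (k : E →L[ℝ] E) :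
    toCoord x₀ x (ofCoord x₀ x k) = k := by
  rw [toCoord_ofCoord h₀ h₀, tcc_self h₀, one_mul, mul_one]

theorem ofCoord_toCoord {x₀ x : M} (h₀ : x ∈ (chartAt E x₀).source) (k : E →L[ℝ] E) :
    ofCoord x₀ x (toCoord x₀ x k) = k := by
  have hx := mem_chart_source E x
  have e := tcc_mul hx h₀ hx
  rw [tcc_self hx] at e
  rw [toCoord, ofCoord]
  calc _ = (tangentCoordChange 𝓘(ℝ, E) x₀ x x * tangentCoordChange 𝓘(ℝ, E) x x₀ x) * k *
        (tangentCoordChange 𝓘(ℝ, E) x₀ x x * tangentCoordChange 𝓘(ℝ, E) x x₀ x) := by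
        simp only [mul_assoc]
    _ = k := by rw [e, one_mul, mul_one]

theorem toCoord_sq {x₀ x : M} (h₀ : x ∈ (chartAt E x₀).source) {k : E →L[ℝ] E}
    (hk : k * k = -1) : toCoord x₀ x k * toCoord x₀ x k = -1 := by
  have hx := mem_chart_source E x
  have e := tcc_mul hx h₀ hx
  have e' := tcc_mul h₀ hx h₀
  rw [tcc_self hx] at e
  rw [tcc_self h₀] at e'
  rw [toCoord]
  calc _ = tangentCoordChange 𝓘(ℝ, E) x x₀ x * (k *
        (tangentCoordChange 𝓘(ℝ, E) x₀ x x * tangentCoordChange 𝓘(ℝ, E) x x₀ x) * k) *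
        tangentCoordChange 𝓘(ℝ, E) x₀ x x := by simp only [mul_assoc]
    _ = -1 := by rw [e, mul_one, hk, mul_neg, mul_one, neg_mul, e']

theorem ofCoord_sq {x₀ x : M} (h₀ : x ∈ (chartAt E x₀).source) {k : E →L[ℝ] E}
    (hk : k * k = -1) : ofCoord x₀ x k * ofCoord x₀ x k = -1 := by
  have hx := mem_chart_source E x
  have e := tcc_mul hx h₀ hx
  have e' := tcc_mul h₀ hx h₀
  rw [tcc_self hx] at e
  rw [tcc_self h₀] at e'
  rw [ofCoord]
  calc _ = tangentCoordChange 𝓘(ℝ, E) x₀ x x * (k *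
        (tangentCoordChange 𝓘(ℝ, E) x x₀ x * tangentCoordChange 𝓘(ℝ, E) x₀ x x) * k) *
        tangentCoordChange 𝓘(ℝ, E) x x₀ x := by simp only [mul_assoc]
    _ = -1 := by rw [e', mul_one, hk, mul_neg, mul_one, neg_mul, e]

namespace TwistorSpace

/-- The complex structure of `p`, as an endomorphism of the model space. -/
def strE (p : TwistorSpace E M) : E →L[ℝ] E := p.str

theorem strE_sq (p : TwistorSpace E M) : p.strE * p.strE = -1 := by
  ext v; exact p.sq v

theorem ext' {p q : TwistorSpace E M} (h : p.pt = q.pt) (h' : p.strE = q.strE) : p = q := by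
  obtain ⟨x, j, hj⟩ := p
  obtain ⟨y, k, hk⟩ := q
  obtain rfl : x = y := h
  obtain rfl : j = k := h'
  rfl

theorem stdJ_sq' (p : TwistorSpace E M) : stdJ E * stdJ E = -1 := stdJ_sq p.strE_sq

/-- The expression of the complex structure of `p` in the preferred chart of `M` at `x₀`. -/
def coord (x₀ : M) (p : TwistorSpace E M) : E →L[ℝ] E := toCoord x₀ p.pt p.strE

theorem coord_sq {x₀ : M} {p : TwistorSpace E M} (h : p.pt ∈ (chartAt E x₀).source) :
    p.coord x₀ * p.coord x₀ = -1 := toCoord_sq h p.strE_sq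

theorem coord_self (p : TwistorSpace E M) : p.coord p.pt = p.strE := by
  rw [coord, toCoord, tcc_self (mem_chart_source E p.pt), one_mul, mul_one]

variable [FiniteDimensional ℝ E]

/-- A complex frame at `p`: an isomorphism carrying the reference structure to that of `p`. -/
def frame (p : TwistorSpace E M) : (E →L[ℝ] E)ˣ :=
  (exists_conj p.stdJ_sq' p.strE_sq).choose

theorem frame_spec (p : TwistorSpace E M) :
    p.strE = p.frame * stdJ E * ↑p.frame⁻¹ :=
  (exists_conj p.stdJ_sq' p.strE_sq).choose_spec

/-- The expression of the complex structure of `p` in the frame of `p₀`. -/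
def framed (p₀ p : TwistorSpace E M) : E →L[ℝ] E :=
  ↑p₀.frame⁻¹ * p.coord p₀.pt * p₀.frame

theorem framed_sq {p₀ p : TwistorSpace E M} (h : p.pt ∈ (chartAt E p₀.pt).source) :
    p₀.framed p * p₀.framed p = -1 := by
  have := coord_sq h
  rw [framed]
  calc _ = ↑p₀.frame⁻¹ * (p.coord p₀.pt * (p₀.frame * ↑p₀.frame⁻¹) * p.coord p₀.pt) * p₀.frame := by
        simp only [mul_assoc]
    _ = -1 := by simp [this]

theorem framed_self (p : TwistorSpace E M) : p.framed p = stdJ E := by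
  have h := p.frame_spec
  rw [framed, coord_self]
  generalize p.strE = k at h
  rw [h]
  simp [mul_assoc]

/-- The endomorphism whose expression in the frame of `p₀` is `k`. -/
def unframe (p₀ : TwistorSpace E M) (k : E →L[ℝ] E) : E →L[ℝ] E :=
  p₀.frame * k * ↑p₀.frame⁻¹

theorem unframe_sq (p₀ : TwistorSpace E M) {k : E →L[ℝ] E} (hk : k * k = -1) :
    p₀.unframe k * p₀.unframe k = -1 := by
  calc _ = (p₀.frame : E →L[ℝ] E) * (k * (↑p₀.frame⁻¹ * p₀.frame) * k) * ↑p₀.frame⁻¹ := by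
        simp only [unframe, mul_assoc]
    _ = -1 := by simp [hk]

/-- The point of `J(M)` with chart coordinates `y` in the chart centred at `p₀` (and `p₀` for `y`
outside the target). -/
def chartInv (p₀ : TwistorSpace E M) (y : TwistorModel E) : TwistorSpace E M :=
  open Classical in
  if h : y.1 ∈ (chartAt E p₀.pt).target ∧ IsUnit (1 + (y.2 : E →L[ℝ] E)) then
    { pt := (chartAt E p₀.pt).symm y.1
      str := ofCoord (E := E) p₀.pt ((chartAt E p₀.pt).symm y.1)
        (p₀.unframe (icay (stdJ E) (y.2 : E →L[ℝ] E)))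
      sq := fun v : E => congr($(ofCoord_sq (x₀ := p₀.pt) ((chartAt E p₀.pt).map_target h.1)
        (p₀.unframe_sq (icay_sq p₀.stdJ_sq' h.2))) v) }
  else p₀

theorem chartInv_pt {p₀ : TwistorSpace E M} {y : TwistorModel E}
    (h : y.1 ∈ (chartAt E p₀.pt).target ∧ IsUnit (1 + (y.2 : E →L[ℝ] E))) :
    (p₀.chartInv y).pt = (chartAt E p₀.pt).symm y.1 := by
  rw [chartInv, dif_pos h]

theorem chartInv_strE {p₀ : TwistorSpace E M} {y : TwistorModel E}
    (h : y.1 ∈ (chartAt E p₀.pt).target ∧ IsUnit (1 + (y.2 : E →L[ℝ] E))) :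
    (p₀.chartInv y).strE = ofCoord p₀.pt ((chartAt E p₀.pt).symm y.1)
        (p₀.unframe (icay (stdJ E) (y.2 : E →L[ℝ] E))) := by
  unfold chartInv
  rw [dif_pos h]; rfl

theorem framed_chartInv {p₀ p₁ : TwistorSpace E M} {y : TwistorModel E}
    (h : y.1 ∈ (chartAt E p₀.pt).target ∧ IsUnit (1 + (y.2 : E →L[ℝ] E)))
    (h' : (chartAt E p₀.pt).symm y.1 ∈ (chartAt E p₁.pt).source) :
    p₁.framed (p₀.chartInv y) = ↑p₁.frame⁻¹ *
      (tangentCoordChange 𝓘(ℝ, E) p₀.pt p₁.pt ((chartAt E p₀.pt).symm y.1) *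
      p₀.unframe (icay (stdJ E) (y.2 : E →L[ℝ] E)) *
      tangentCoordChange 𝓘(ℝ, E) p₁.pt p₀.pt ((chartAt E p₀.pt).symm y.1)) * p₁.frame := by
  rw [framed, coord, chartInv_strE h, chartInv_pt h,
    toCoord_ofCoord ((chartAt E p₀.pt).map_target h.1) h']

theorem framed_chartInv_self {p₀ : TwistorSpace E M} {y : TwistorModel E}
    (h : y.1 ∈ (chartAt E p₀.pt).target ∧ IsUnit (1 + (y.2 : E →L[ℝ] E))) :
    p₀.framed (p₀.chartInv y) = icay (stdJ E) (y.2 : E →L[ℝ] E) := by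
  have hs := (chartAt E p₀.pt).map_target h.1
  rw [framed_chartInv h hs, tcc_self hs, unframe]
  simp [mul_assoc]

/-- The chart of `J(M)` centred at `p₀`: the preferred chart of `M` at the base point of `p₀` in the
base direction, and the Cayley transform in the fibre direction. -/
def chart (p₀ : TwistorSpace E M) : PartialEquiv (TwistorSpace E M) (TwistorModel E) where
  toFun p := (chartAt E p₀.pt p.pt, antiProj E (cay (stdJ E) (p₀.framed p)))
  invFun y := p₀.chartInv y
  source := {p | p.pt ∈ (chartAt E p₀.pt).source ∧ IsUnit (p₀.framed p + stdJ E)}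
  target := {y | y.1 ∈ (chartAt E p₀.pt).target ∧ IsUnit (1 + (y.2 : E →L[ℝ] E))}
  map_source' p hp := by
    refine ⟨(chartAt E p₀.pt).map_source hp.1, ?_⟩
    change IsUnit (1 + (antiProj E (cay (stdJ E) (p₀.framed p)) : E →L[ℝ] E))
    rw [antiProj_coe p.stdJ_sq' (cay_anti p.stdJ_sq' (framed_sq hp.1) hp.2)]
    exact isUnit_one_add_cay (framed_sq hp.1) hp.2
  map_target' y hy := by
    refine ⟨?_, ?_⟩
    · rw [chartInv_pt hy]; exact (chartAt E p₀.pt).map_target hy.1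
    · rw [framed_chartInv_self hy]
      exact isUnit_icay_add p₀.stdJ_sq' y.2.2 hy.2
  left_inv' p hp := by
    have hc : (antiProj E (cay (stdJ E) (p₀.framed p)) : E →L[ℝ] E) = cay (stdJ E) (p₀.framed p) :=
      antiProj_coe p.stdJ_sq' (cay_anti p.stdJ_sq' (framed_sq hp.1) hp.2)
    have h : chartAt E p₀.pt p.pt ∈ (chartAt E p₀.pt).target ∧
        IsUnit (1 + (antiProj E (cay (stdJ E) (p₀.framed p)) : E →L[ℝ] E)) := by
      refine ⟨(chartAt E p₀.pt).map_source hp.1, ?_⟩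
      rw [hc]
      exact isUnit_one_add_cay (framed_sq hp.1) hp.2
    have hpt : (chartAt E p₀.pt).symm (chartAt E p₀.pt p.pt) = p.pt :=
      (chartAt E p₀.pt).left_inv hp.1
    apply ext'
    · rw [chartInv_pt h]; exact hpt
    · rw [chartInv_strE h]
      simp only [hc, hpt]
      rw [icay_cay p.stdJ_sq' (framed_sq hp.1) hp.2, framed]
      have : p₀.unframe (↑p₀.frame⁻¹ * p.coord p₀.pt * p₀.frame) = p.coord p₀.pt := by
        simp [unframe, mul_assoc]
      rw [this, coord, ofCoord_toCoord hp.1]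
  right_inv' y hy := by
    have hy' : y.1 ∈ (chartAt E p₀.pt).target ∧ IsUnit (1 + (y.2 : E →L[ℝ] E)) := hy
    apply Prod.ext
    · simp only [chartInv_pt hy']
      exact (chartAt E p₀.pt).right_inv hy.1
    · apply Subtype.ext
      simp only [framed_chartInv_self hy', cay_icay p₀.stdJ_sq' y.2.2 hy'.2]
      exact antiProj_coe p₀.stdJ_sq' y.2.2

theorem mem_chart_source (p : TwistorSpace E M) : p ∈ p.chart.source := by
  refine ⟨_root_.mem_chart_source E p.pt, ?_⟩
  rw [framed_self, ← two_smul ℝ, Algebra.smul_def]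
  exact ((isUnit_iff_ne_zero.2 two_ne_zero).map _).mul (isUnit_of_sq p.stdJ_sq')

/-- The complex structure in the frame of `p₁` as a function of the chart coordinates at `p₀`. -/
def transFun (p₀ p₁ : TwistorSpace E M) (y : TwistorModel E) : E →L[ℝ] E :=
  ↑p₁.frame⁻¹ *
      (tangentCoordChange 𝓘(ℝ, E) p₀.pt p₁.pt ((chartAt E p₀.pt).symm y.1) *
      p₀.unframe (icay (stdJ E) (y.2 : E →L[ℝ] E)) *
      tangentCoordChange 𝓘(ℝ, E) p₁.pt p₀.pt ((chartAt E p₀.pt).symm y.1)) * p₁.frame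

/-- The domain of `transFun`. -/
def transDom (p₀ p₁ : TwistorSpace E M) : Set (TwistorModel E) :=
  {y | y.1 ∈ ((chartAt E p₀.pt).symm ≫ₕ chartAt E p₁.pt).source ∧ IsUnit (1 + (y.2 : E →L[ℝ] E))}

theorem contDiffOn_trans_base (x₀ x₁ : M) :
    ContDiffOn ℝ ∞ ((chartAt E x₀).symm ≫ₕ chartAt E x₁)
      ((chartAt E x₀).symm ≫ₕ chartAt E x₁).source := by
  have := (𝓘(ℝ, E)).contDiffOn_extendCoordChange (n := ∞)
    (IsManifold.chart_mem_maximalAtlas (I := 𝓘(ℝ, E)) x₀)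
    (IsManifold.chart_mem_maximalAtlas (I := 𝓘(ℝ, E)) x₁)
  simpa using! this

theorem contDiffOn_tcc (x₀ x₁ : M) :
    ContDiffOn ℝ ∞ (fun e => tangentCoordChange 𝓘(ℝ, E) x₀ x₁ ((chartAt E x₀).symm e))
      ((chartAt E x₀).symm ≫ₕ chartAt E x₁).source := by
  have h : IsManifold 𝓘(ℝ, E) (∞ + 1) M := by simpa
  have := contDiffOn_fderiv_coord_change (I := 𝓘(ℝ, E)) (n := ∞) (achart E x₀) (achart E x₁)
  refine (this.mono ?_).congr ?_
  · intro e he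
    simpa using he
  · intro e he
    rw [tangentCoordChange_def]
    have : extChartAt 𝓘(ℝ, E) x₀ ((chartAt E x₀).symm e) = e := by
      simpa using (chartAt E x₀).right_inv (by simpa using he.1)
    rw [this]
    rfl

theorem isOpen_transDom (p₀ p₁ : TwistorSpace E M) : IsOpen (transDom p₀ p₁) := by
  have : CompleteSpace E := FiniteDimensional.complete ℝ E
  refine IsOpen.inter ?_ ?_
  · exact ((chartAt E p₀.pt).symm ≫ₕ chartAt E p₁.pt).open_source.preimage continuous_fst
  · exact Units.isOpen.preimage (by fun_prop : Continuous fun y : TwistorModel E =>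
      1 + (y.2 : E →L[ℝ] E))

theorem contDiff_antiProj : ContDiff ℝ ∞ (antiProj E) := by
  exact ContinuousLinearMap.contDiff (𝕜 := ℝ) (E := E →L[ℝ] E) (F := antiEnd E) (antiProj E)

theorem contDiff_coe : ContDiff ℝ ∞ (fun a : antiEnd E => (a : E →L[ℝ] E)) := by
  have h := ContinuousLinearMap.contDiff (𝕜 := ℝ) (n := ∞) (E := antiEnd E) (F := E →L[ℝ] E)
    (antiEnd E).subtypeL
  exact h

theorem contDiffAt_icay {a : E →L[ℝ] E} (ha : IsUnit (1 + a)) (j₀ : E →L[ℝ] E) :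
    ContDiffAt ℝ ∞ (icay j₀) a := by
  have : CompleteSpace E := FiniteDimensional.complete ℝ E
  obtain ⟨u, hu⟩ := ha
  have h1 : ContDiffAt ℝ ∞ (fun a : E →L[ℝ] E => Ring.inverse (1 + a)) a := by
    have := contDiffAt_ringInverse ℝ (n := ∞) u
    rw [hu] at this
    exact this.comp (f := fun a : E →L[ℝ] E => 1 + a) a (contDiffAt_const.add contDiffAt_id)
  exact ((contDiffAt_const.add contDiffAt_id).mul contDiffAt_const).mul h1

theorem contDiffAt_cay {j : E →L[ℝ] E} {j₀ : E →L[ℝ] E} (hj : IsUnit (j + j₀)) :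
    ContDiffAt ℝ ∞ (cay j₀) j := by
  have : CompleteSpace E := FiniteDimensional.complete ℝ E
  obtain ⟨u, hu⟩ := hj
  have h1 : ContDiffAt ℝ ∞ (fun a : E →L[ℝ] E => Ring.inverse (a + j₀)) j := by
    have := contDiffAt_ringInverse ℝ (n := ∞) u
    rw [hu] at this
    exact this.comp (f := fun a : E →L[ℝ] E => a + j₀) j (contDiffAt_id.add contDiffAt_const)
  exact (contDiffAt_id.sub contDiffAt_const).mul h1

theorem contDiffOn_transFun (p₀ p₁ : TwistorSpace E M) :
    ContDiffOn ℝ ∞ (transFun p₀ p₁) (transDom p₀ p₁) := by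
  have h1 : ContDiffOn ℝ ∞ (fun y : TwistorModel E => tangentCoordChange 𝓘(ℝ, E) p₀.pt p₁.pt
      ((chartAt E p₀.pt).symm y.1)) (transDom p₀ p₁) :=
    (contDiffOn_tcc p₀.pt p₁.pt).comp (f := fun y : TwistorModel E => y.1)
      contDiff_fst.contDiffOn fun y hy => hy.1
  have h2 : ContDiffOn ℝ ∞ (fun y : TwistorModel E => tangentCoordChange 𝓘(ℝ, E) p₁.pt p₀.pt
      ((chartAt E p₀.pt).symm y.1)) (transDom p₀ p₁) := by
    have hc := contDiffOn_trans_base (E := E) p₀.pt p₁.pt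
    have h3 : ContDiffOn ℝ ∞ (fun y : TwistorModel E =>
        ((chartAt E p₀.pt).symm ≫ₕ chartAt E p₁.pt) y.1) (transDom p₀ p₁) :=
      hc.comp (f := fun y : TwistorModel E => y.1) contDiff_fst.contDiffOn fun y hy => hy.1
    refine ((contDiffOn_tcc p₁.pt p₀.pt).comp h3 ?_).congr ?_
    · intro y hy
      have h4 := ((chartAt E p₀.pt).symm ≫ₕ chartAt E p₁.pt).map_source hy.1
      simpa using h4
    · intro y hy
      have h4 := hy.1
      simp only [Function.comp_apply]
      congr 1
      simp at h4
      simp [h4.2]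
  have h3 : ContDiffOn ℝ ∞ (fun y : TwistorModel E => icay (stdJ E) (y.2 : E →L[ℝ] E))
      (transDom p₀ p₁) := by
    intro y hy
    refine ContDiffAt.contDiffWithinAt ?_
    exact (contDiffAt_icay hy.2 _).comp y (f := fun y : TwistorModel E => (y.2 : E →L[ℝ] E))
      ((contDiff_coe (E := E)).comp contDiff_snd).contDiffAt
  have hu : ContDiffOn ℝ ∞ (fun y : TwistorModel E => p₀.unframe (icay (stdJ E) (y.2 : E →L[ℝ] E)))
      (transDom p₀ p₁) := (contDiffOn_const.mul h3).mul contDiffOn_const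
  exact (contDiffOn_const.mul ((h1.mul hu).mul
    h2)).mul contDiffOn_const

theorem trans_source (p₀ p₁ : TwistorSpace E M) :
    (p₀.chart.symm.trans p₁.chart).source =
      transDom p₀ p₁ ∩ transFun p₀ p₁ ⁻¹' {k | IsUnit (k + stdJ E)} := by
  ext y
  constructor
  · rintro ⟨hy, hy'⟩
    have h : y.1 ∈ (chartAt E p₀.pt).target ∧ IsUnit (1 + (y.2 : E →L[ℝ] E)) := hy
    have h1 : (p₀.chartInv y).pt ∈ (chartAt E p₁.pt).source := hy'.1
    have h2 : IsUnit (p₁.framed (p₀.chartInv y) + stdJ E) := hy'.2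
    rw [chartInv_pt h] at h1
    rw [framed_chartInv h h1] at h2
    exact ⟨⟨⟨h.1, h1⟩, h.2⟩, h2⟩
  · rintro ⟨⟨⟨h, h1⟩, h'⟩, h2⟩
    have h3 : y.1 ∈ (chartAt E p₀.pt).target ∧ IsUnit (1 + (y.2 : E →L[ℝ] E)) := ⟨h, h'⟩
    refine ⟨h3, ?_, ?_⟩
    · change (p₀.chartInv y).pt ∈ (chartAt E p₁.pt).source
      rw [chartInv_pt h3]; exact h1
    · change IsUnit (p₁.framed (p₀.chartInv y) + stdJ E)
      rw [framed_chartInv h3 h1]; exact h2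

theorem trans_apply {p₀ p₁ : TwistorSpace E M} {y : TwistorModel E} (hy : y ∈ transDom p₀ p₁) :
    (p₀.chart.symm.trans p₁.chart) y =
      (((chartAt E p₀.pt).symm ≫ₕ chartAt E p₁.pt) y.1,
        antiProj E (cay (stdJ E) (transFun p₀ p₁ y))) := by
  obtain ⟨⟨h, h1⟩, h'⟩ := hy
  have h3 : y.1 ∈ (chartAt E p₀.pt).target ∧ IsUnit (1 + (y.2 : E →L[ℝ] E)) := ⟨h, h'⟩
  change (chartAt E p₁.pt (p₀.chartInv y).pt,
    antiProj E (cay (stdJ E) (p₁.framed (p₀.chartInv y)))) = _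
  rw [framed_chartInv h3 h1, chartInv_pt h3]
  rfl

theorem isOpen_trans_source (p₀ p₁ : TwistorSpace E M) :
    IsOpen (p₀.chart.symm.trans p₁.chart).source := by
  have : CompleteSpace E := FiniteDimensional.complete ℝ E
  rw [trans_source]
  exact (contDiffOn_transFun p₀ p₁).continuousOn.isOpen_inter_preimage (isOpen_transDom p₀ p₁)
    (Units.isOpen.preimage (by fun_prop : Continuous fun k : E →L[ℝ] E => k + stdJ E))

theorem contDiffOn_trans (p₀ p₁ : TwistorSpace E M) :
    ContDiffOn ℝ ∞ (p₀.chart.symm.trans p₁.chart) (p₀.chart.symm.trans p₁.chart).source := by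
  have hc := contDiffOn_trans_base (E := E) p₀.pt p₁.pt
  rw [trans_source]
  refine ContDiffOn.congr (f := fun y => (((chartAt E p₀.pt).symm ≫ₕ chartAt E p₁.pt) y.1,
        antiProj E (cay (stdJ E) (transFun p₀ p₁ y)))) ?_ fun y hy => trans_apply hy.1
  refine ContDiffOn.prodMk ?_ ?_
  · exact hc.comp (f := fun y : TwistorModel E => y.1) contDiff_fst.contDiffOn fun y hy => hy.1.1
  · refine (contDiff_antiProj (E := E)).comp_contDiffOn ?_
    intro y hy
    exact (contDiffAt_cay hy.2).comp_contDiffWithinAt y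
      (((contDiffOn_transFun p₀ p₁) y hy.1).mono inter_subset_left)

variable (E M) in
/-- The atlas of `J(M)`. -/
def core : ChartedSpaceCore (TwistorModel E) (TwistorSpace E M) where
  atlas := range chart
  chartAt := chart
  mem_chart_source := mem_chart_source
  chart_mem_atlas p := ⟨p, rfl⟩
  open_source := by
    rintro _ _ ⟨p, rfl⟩ ⟨q, rfl⟩
    exact isOpen_trans_source p q
  continuousOn_toFun := by
    rintro _ _ ⟨p, rfl⟩ ⟨q, rfl⟩
    exact (contDiffOn_trans p q).continuousOn

instance : TopologicalSpace (TwistorSpace E M) := (core E M).toTopologicalSpace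

instance : ChartedSpace (TwistorModel E) (TwistorSpace E M) := (core E M).toChartedSpace

instance : IsManifold 𝓘(ℝ, TwistorModel E) ∞ (TwistorSpace E M) := by
  apply isManifold_of_contDiffOn
  intro e e' he he'
  simp only [atlas, ChartedSpace.atlas, mem_iUnion,
    mem_singleton_iff] at he he'
  obtain ⟨_, ⟨p, rfl⟩, rfl⟩ := he
  obtain ⟨_, ⟨q, rfl⟩, rfl⟩ := he'
  have := contDiffOn_trans p q
  simpa using! this

end TwistorSpace
end Charts
end Twistor

namespace Twistor

section IcayDeriv
variable {R : Type*} [NormedRing R] [NormedAlgebra ℝ R] [CompleteSpace R]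

theorem hasFDerivAt_icay (j₀ : R) :
    HasFDerivAt (icay j₀) ((ContinuousLinearMap.mul ℝ R).flip j₀ -
      ContinuousLinearMap.mul ℝ R j₀) 0 := by
  have h1 : HasFDerivAt (fun a : R => 1 + a) (ContinuousLinearMap.id ℝ R) 0 :=
    (hasFDerivAt_id _).const_add 1
  have h2 : HasFDerivAt (fun a : R => (1 + a) * j₀) _ 0 := h1.mul_const' j₀
  have h3 := hasFDerivAt_ringInverse (𝕜 := ℝ) (1 : Rˣ)
  have h4 : HasFDerivAt (fun a : R => Ring.inverse (1 + a)) _ 0 :=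
    HasFDerivAt.comp (f := fun a : R => 1 + a) (g := Ring.inverse) 0
      (by simpa only [add_zero, Units.val_one] using! h3) h1
  refine (h2.mul' h4).congr_fderiv ?_
  refine ContinuousLinearMap.ext fun a => ?_
  simp only [add_apply, sub_apply, smul_apply, ContinuousLinearMap.neg_comp, neg_apply,
    ContinuousLinearMap.comp_apply, ContinuousLinearMap.id_apply, ContinuousLinearMap.flip_apply,
    ContinuousLinearMap.mul_apply', ContinuousLinearMap.mulLeftRight_apply, inv_one, Units.val_one,
    add_zero, one_mul, mul_one, Ring.inverse_one, smul_eq_mul, MulOpposite.smul_eq_mul_unop,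
    MulOpposite.unop_op]
  rw [mul_neg]
  abel

end IcayDeriv

section Conn
variable {E : Type*} [NormedAddCommGroup E] [NormedSpace ℝ E] [FiniteDimensional ℝ E]
  {M : Type*} [TopologicalSpace M] [ChartedSpace E M] [IsManifold 𝓘(ℝ, E) ∞ M]

namespace TwistorSpace

/-- The differential at `p` of the bundle projection `J(M) → M`. -/
def dproj (p : TwistorSpace E M) :
    TangentSpace 𝓘(ℝ, TwistorModel E) p →L[ℝ] TangentSpace 𝓘(ℝ, E) p.pt :=
  mfderiv 𝓘(ℝ, TwistorModel E) 𝓘(ℝ, E) (fun q : TwistorSpace E M => q.pt) p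

/-- The pull-back to `J(M)` of a connection in `TM`, acting on a section `s` of the pull-back of
`TM` to `J(M)`. In the local frame of `TM` given by the chart at the base point of `p`, one
differentiates the components of `s` and adds the connection form of `∇` evaluated on `dπ u`;
`FiberBundle.extend E w` is the vector field with constant components in that frame and value `w`
at the base point. -/
def pullbackCov (cov : CovariantDerivative 𝓘(ℝ, E) E (TangentSpace 𝓘(ℝ, E) : M → Type _))
    (s : (q : TwistorSpace E M) → TangentSpace 𝓘(ℝ, E) q.pt) (p : TwistorSpace E M) :
    TangentSpace 𝓘(ℝ, TwistorModel E) p →L[ℝ] TangentSpace 𝓘(ℝ, E) p.pt :=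
  (((trivializationAt E (TangentSpace 𝓘(ℝ, E)) p.pt).symmL ℝ p.pt).comp
    (mfderiv 𝓘(ℝ, TwistorModel E) 𝓘(ℝ, E) (fun q : TwistorSpace E M =>
      ((trivializationAt E (TangentSpace 𝓘(ℝ, E)) p.pt) ⟨q.pt, s q⟩).2) p)) +
  (cov (FiberBundle.extend E (s p)) p.pt).comp p.dproj

/-- The covariant differential `π^*∇ 𝒥` of the canonical section `𝒥` of the pull-back of `End TM`,
that is `(∇_u 𝒥) v = ∇_u (𝒥 V) - 𝒥 (∇_u V)` for a section `V` extending `v`. -/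
def nablaJ (cov : CovariantDerivative 𝓘(ℝ, E) E (TangentSpace 𝓘(ℝ, E) : M → Type _))
    (p : TwistorSpace E M) (u : TangentSpace 𝓘(ℝ, TwistorModel E) p)
    (v : TangentSpace 𝓘(ℝ, E) p.pt) : TangentSpace 𝓘(ℝ, E) p.pt :=
  pullbackCov cov (fun q => q.str (FiberBundle.extend E v q.pt)) p u -
    p.str (pullbackCov cov (fun q => FiberBundle.extend E v q.pt) p u)

/-- The conditions `dπ(J u) = 𝒥 dπ(u)` and `π^*∇_{J u} 𝒥 = 𝒥 π^*∇_u 𝒥` that characterize the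
almost complex structure of a connection. -/
def IsTwistorStructure
    (cov : CovariantDerivative 𝓘(ℝ, E) E (TangentSpace 𝓘(ℝ, E) : M → Type _))
    (J : (p : TwistorSpace E M) → TangentSpace 𝓘(ℝ, TwistorModel E) p →L[ℝ]
      TangentSpace 𝓘(ℝ, TwistorModel E) p) : Prop :=
  ∀ p u, p.dproj (J p u) = p.str (p.dproj u) ∧
    ∀ v, nablaJ cov p (J p u) v = p.str (nablaJ cov p u v)

theorem chartAt_eq (p q : TwistorSpace E M) : chartAt (TwistorModel E) p q = p.chart q := rfl

theorem chartAt_symm_eq (p : TwistorSpace E M) (y : TwistorModel E) :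
    (chartAt (TwistorModel E) p).symm y = p.chartInv y := rfl

theorem chart_self (p : TwistorSpace E M) : p.chart p = (chartAt E p.pt p.pt, 0) := by
  change (chartAt E p.pt p.pt, antiProj E (cay (stdJ E) (p.framed p))) = _
  rw [framed_self, cay, sub_self, zero_mul]
  congr 1
  exact ContinuousLinearMap.map_zero (antiProj E)

theorem target_mem (p : TwistorSpace E M) :
    p.chart.target ∈ 𝓝 (p.chart p) := by
  have := (chartAt (TwistorModel E) p).open_target.mem_nhds
    ((chartAt (TwistorModel E) p).map_source (_root_.mem_chart_source _ p))
  exact this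

theorem hasMFDerivAt_pt (p : TwistorSpace E M) :
    HasMFDerivAt 𝓘(ℝ, TwistorModel E) 𝓘(ℝ, E) (fun q : TwistorSpace E M => q.pt) p
      (ContinuousLinearMap.fst ℝ E (antiEnd E)) := by
  have hev : ∀ᶠ y in 𝓝 (p.chart p), (p.chartInv y).pt = (chartAt E p.pt).symm y.1 := by
    filter_upwards [p.target_mem] with y hy
    exact chartInv_pt hy
  constructor
  · refine ((chartAt (TwistorModel E) p).symm.continuousAt_iff_continuousAt_comp_right
      (x := p) (_root_.mem_chart_source (TwistorModel E) p)).2 ?_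
    change ContinuousAt ((fun q : TwistorSpace E M => q.pt) ∘ p.chartInv) (p.chart p)
    refine ContinuousAt.congr (f := fun y : TwistorModel E => (chartAt E p.pt).symm y.1) ?_
      (hev.mono fun y hy => hy.symm)
    rw [chart_self]
    refine ContinuousAt.comp (f := fun y : TwistorModel E => y.1) ?_ continuousAt_fst
    exact (chartAt E p.pt).continuousAt_symm
      ((chartAt E p.pt).map_source (_root_.mem_chart_source E p.pt))
  · simp only [mfld_simps]
    change HasFDerivWithinAt ((chartAt E p.pt) ∘ (fun q : TwistorSpace E M => q.pt) ∘ p.chartInv)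
      (ContinuousLinearMap.fst ℝ E (antiEnd E)) univ (p.chart p)
    rw [hasFDerivWithinAt_univ]
    refine HasFDerivAt.congr_of_eventuallyEq
      (ContinuousLinearMap.fst ℝ E (antiEnd E)).hasFDerivAt ?_
    filter_upwards [hev, p.target_mem] with y hy hy'
    simp only [Function.comp_apply, hy]
    exact (chartAt E p.pt).right_inv hy'.1

theorem dproj_eq (p : TwistorSpace E M) (u : TangentSpace 𝓘(ℝ, TwistorModel E) p) :
    p.dproj u = (show TwistorModel E from u).1 := by
  rw [dproj, (hasMFDerivAt_pt p).mfderiv]; rfl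

theorem triv_apply {x y : M} (w : TangentSpace 𝓘(ℝ, E) y) :
    ((trivializationAt E (TangentSpace 𝓘(ℝ, E)) x) ⟨y, w⟩).2 =
      tangentCoordChange 𝓘(ℝ, E) y x y w := rfl

theorem extend_apply {x y : M} (hy : y ∈ (chartAt E x).source) (v : TangentSpace 𝓘(ℝ, E) x) :
    FiberBundle.extend E v y = tangentCoordChange 𝓘(ℝ, E) x y y v := by
  have h1 : ((trivializationAt E (TangentSpace 𝓘(ℝ, E)) x) ⟨x, v⟩).2 = v := by
    rw [triv_apply, tcc_self (_root_.mem_chart_source E x)]; rfl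
  rw [FiberBundle.extend, h1]
  have h2 := Trivialization.symmL_apply (R := ℝ) (trivializationAt E (TangentSpace 𝓘(ℝ, E)) x)
    (b := y) (by simpa using hy) (show E from v)
  rw [TangentBundle.symmL_trivializationAt_eq_core hy] at h2
  exact h2.symm

theorem symmL_self (x : M) (v : E) :
    (trivializationAt E (TangentSpace 𝓘(ℝ, E)) x).symmL ℝ x v = v := by
  rw [TangentBundle.symmL_trivializationAt_eq_core (_root_.mem_chart_source E x)]
  exact congr($(tcc_self (_root_.mem_chart_source E x)) v)

theorem coord_chartInv {p : TwistorSpace E M} {y : TwistorModel E} (hy : y ∈ p.chart.target) :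
    (p.chartInv y).coord p.pt = p.unframe (icay (stdJ E) (y.2 : E →L[ℝ] E)) := by
  have hy' : y.1 ∈ (chartAt E p.pt).target ∧ IsUnit (1 + (y.2 : E →L[ℝ] E)) := hy
  have hs := (chartAt E p.pt).map_target hy'.1
  rw [coord, chartInv_strE hy', chartInv_pt hy', toCoord_ofCoord hs hs, tcc_self hs]
  simp

/-- The linear map `a ↦ g (a j₀ - j₀ a) g⁻¹`, where `g` is the frame of `p`. -/
def fibreLin (p : TwistorSpace E M) : antiEnd E →L[ℝ] (E →L[ℝ] E) :=
  ((ContinuousLinearMap.mul ℝ (E →L[ℝ] E) (p.frame : E →L[ℝ] E)).comp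
    ((ContinuousLinearMap.mul ℝ (E →L[ℝ] E)).flip (↑p.frame⁻¹ : E →L[ℝ] E))).comp
  (((ContinuousLinearMap.mul ℝ (E →L[ℝ] E)).flip (stdJ E) -
    ContinuousLinearMap.mul ℝ (E →L[ℝ] E) (stdJ E)).comp (antiEnd E).subtypeL)

theorem fibreLin_apply (p : TwistorSpace E M) (a : antiEnd E) :
    p.fibreLin a = p.unframe ((2 : ℝ) • ((a : E →L[ℝ] E) * stdJ E)) := by
  have h : stdJ E * (a : E →L[ℝ] E) = -((a : E →L[ℝ] E) * stdJ E) := by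
    rw [mem_antiEnd.1 a.2, neg_neg]
  simp only [fibreLin, ContinuousLinearMap.comp_apply, sub_apply,
    ContinuousLinearMap.flip_apply, ContinuousLinearMap.mul_apply', Submodule.subtypeL_apply,
    unframe, h, sub_neg_eq_add, two_smul, mul_assoc]

theorem hasFDerivAt_coord (p : TwistorSpace E M) :
    HasFDerivAt (fun y : TwistorModel E => p.unframe (icay (stdJ E) (y.2 : E →L[ℝ] E)))
      (p.fibreLin.comp (ContinuousLinearMap.snd ℝ E (antiEnd E))) (p.chart p) := by
  have : CompleteSpace E := FiniteDimensional.complete ℝ E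
  rw [chart_self]
  have h1 : HasFDerivAt (fun y : TwistorModel E => (y.2 : E →L[ℝ] E))
      ((antiEnd E).subtypeL.comp (ContinuousLinearMap.snd ℝ E (antiEnd E)))
      (chartAt E p.pt p.pt, 0) :=
    ((antiEnd E).subtypeL.comp (ContinuousLinearMap.snd ℝ E (antiEnd E))).hasFDerivAt
  have h2 := hasFDerivAt_icay (stdJ E)
  have h3 := HasFDerivAt.comp (f := fun y : TwistorModel E => (y.2 : E →L[ℝ] E))
    (g := icay (stdJ E)) (chartAt E p.pt p.pt, (0 : antiEnd E)) (by exact h2) h1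
  have h4 := (h3.mul_const' (↑p.frame⁻¹ : E →L[ℝ] E)).const_mul (p.frame : E →L[ℝ] E)
  have h5 : (fun y : TwistorModel E => p.unframe (icay (stdJ E) (y.2 : E →L[ℝ] E))) =
      fun y => (p.frame : E →L[ℝ] E) *
        ((icay (stdJ E) ∘ fun y : TwistorModel E => (y.2 : E →L[ℝ] E)) y *
          (↑p.frame⁻¹ : E →L[ℝ] E)) := by
    funext y; simp only [unframe, Function.comp_apply, mul_assoc]
  rw [h5]
  exact h4

theorem hasMFDerivAt_str (p : TwistorSpace E M) (v : TangentSpace 𝓘(ℝ, E) p.pt) :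
    HasMFDerivAt 𝓘(ℝ, TwistorModel E) 𝓘(ℝ, E) (fun q : TwistorSpace E M =>
      ((trivializationAt E (TangentSpace 𝓘(ℝ, E)) p.pt)
        ⟨q.pt, q.str (FiberBundle.extend E v q.pt)⟩).2) p
      ((ContinuousLinearMap.apply ℝ E (show E from v)).comp
        (p.fibreLin.comp (ContinuousLinearMap.snd ℝ E (antiEnd E)))) := by
  have hev : ∀ᶠ y in 𝓝 (p.chart p), ((trivializationAt E (TangentSpace 𝓘(ℝ, E)) p.pt)
        ⟨(p.chartInv y).pt, (p.chartInv y).str (FiberBundle.extend E v (p.chartInv y).pt)⟩).2 =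
      p.unframe (icay (stdJ E) (y.2 : E →L[ℝ] E)) v := by
    filter_upwards [p.target_mem] with y hy
    rw [← coord_chartInv hy]
    have h : (p.chartInv y).pt ∈ (chartAt E p.pt).source := by
      rw [chartInv_pt hy]; exact (chartAt E p.pt).map_target hy.1
    rw [triv_apply, extend_apply h]
    rfl
  have hd : HasFDerivAt (fun y : TwistorModel E =>
      p.unframe (icay (stdJ E) (y.2 : E →L[ℝ] E)) (show E from v))
      ((ContinuousLinearMap.apply ℝ E (show E from v)).comp
        (p.fibreLin.comp (ContinuousLinearMap.snd ℝ E (antiEnd E)))) (p.chart p) :=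
    (ContinuousLinearMap.apply ℝ E (show E from v)).hasFDerivAt.comp (p.chart p)
      p.hasFDerivAt_coord
  constructor
  · refine ((chartAt (TwistorModel E) p).symm.continuousAt_iff_continuousAt_comp_right
      (x := p) (_root_.mem_chart_source (TwistorModel E) p)).2 ?_
    exact hd.continuousAt.congr (hev.mono fun y hy => hy.symm)
  · simp only [mfld_simps]
    refine HasFDerivAt.hasFDerivWithinAt (E := TwistorModel E) (x := p.chart p) ?_
    exact hd.congr_of_eventuallyEq hev

theorem mfderiv_extend (p : TwistorSpace E M) (v : TangentSpace 𝓘(ℝ, E) p.pt) :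
    mfderiv 𝓘(ℝ, TwistorModel E) 𝓘(ℝ, E) (fun q : TwistorSpace E M =>
      ((trivializationAt E (TangentSpace 𝓘(ℝ, E)) p.pt)
        ⟨q.pt, FiberBundle.extend E v q.pt⟩).2) p = 0 := by
  have hc := (hasMFDerivAt_pt p).continuousAt
  have hev : (fun q : TwistorSpace E M => ((trivializationAt E (TangentSpace 𝓘(ℝ, E)) p.pt)
        ⟨q.pt, FiberBundle.extend E v q.pt⟩).2) =ᶠ[𝓝 p] fun _ => (show E from v) := by
    filter_upwards [hc.preimage_mem_nhds ((chartAt E p.pt).open_source.mem_nhds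
      (_root_.mem_chart_source E p.pt))] with q hq
    have hq' : q.pt ∈ (chartAt E p.pt).source := hq
    rw [triv_apply, extend_apply hq']
    have := tcc_mul hq' (_root_.mem_chart_source E q.pt) hq'
    rw [tcc_self hq'] at this
    exact congr($this v)
  rw [hev.mfderiv_eq]
  exact mfderiv_const

theorem extend_eventually (x : M) :
    ∀ᶠ y in 𝓝 x, ∀ v : E, (FiberBundle.extend E (show TangentSpace 𝓘(ℝ, E) x from v) y : E) =
      tangentCoordChange 𝓘(ℝ, E) x y y v := by
  filter_upwards [(chartAt E x).open_source.mem_nhds (_root_.mem_chart_source E x)] with y hy v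
  exact extend_apply hy v

/-- The connection form of `∇` at `x` in the frame of the chart at `x`. -/
def conn (cov : CovariantDerivative 𝓘(ℝ, E) E (TangentSpace 𝓘(ℝ, E) : M → Type _)) (x : M) :
    E →L[ℝ] E →L[ℝ] E :=
  LinearMap.toContinuousLinearMap
    { toFun := fun v => cov (FiberBundle.extend E (show TangentSpace 𝓘(ℝ, E) x from v)) x
      map_add' := fun v w => by
        refine (cov.isCovariantDerivativeOnUniv.congr_of_eventuallyEq
          (FiberBundle.mdifferentiableAt_extend ..)
          (mdifferentiableAt_add_section (FiberBundle.mdifferentiableAt_extend ..)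
            (FiberBundle.mdifferentiableAt_extend ..)) Filter.univ_mem ?_).trans
          (cov.isCovariantDerivativeOnUniv.add
            (σ := FiberBundle.extend E (show TangentSpace 𝓘(ℝ, E) x from v))
            (σ' := FiberBundle.extend E (show TangentSpace 𝓘(ℝ, E) x from w))
            (FiberBundle.mdifferentiableAt_extend ..) (FiberBundle.mdifferentiableAt_extend ..))
        filter_upwards [extend_eventually (E := E) x] with y hy
        have h := map_add (tangentCoordChange 𝓘(ℝ, E) x y y) v w
        rw [← hy, ← hy, ← hy] at h
        exact h
      map_smul' := fun c v => by
        refine (cov.isCovariantDerivativeOnUniv.congr_of_eventuallyEq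
          (FiberBundle.mdifferentiableAt_extend ..)
          (MDifferentiableAt.smul_const_section (a := c)
            (FiberBundle.mdifferentiableAt_extend ..)) Filter.univ_mem ?_).trans
          (cov.isCovariantDerivativeOnUniv.smul_const c
            (σ := FiberBundle.extend E (show TangentSpace 𝓘(ℝ, E) x from v))
            (FiberBundle.mdifferentiableAt_extend ..))
        filter_upwards [extend_eventually (E := E) x] with y hy
        have h := map_smul (tangentCoordChange 𝓘(ℝ, E) x y y) c v
        rw [← hy, ← hy] at h
        exact h }

/-- The value of `π^*∇ 𝒥` at `p` on the vector with chart coordinates `u`. -/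
def nablaJE (cov : CovariantDerivative 𝓘(ℝ, E) E (TangentSpace 𝓘(ℝ, E) : M → Type _))
    (p : TwistorSpace E M) (u : TwistorModel E) : E →L[ℝ] E :=
  p.fibreLin u.2 + ((conn cov p.pt).flip u.1 * p.strE - p.strE * (conn cov p.pt).flip u.1)

theorem nablaJ_eq (cov : CovariantDerivative 𝓘(ℝ, E) E (TangentSpace 𝓘(ℝ, E) : M → Type _))
    (p : TwistorSpace E M) (u : TwistorModel E) (v : E) :
    nablaJ cov p u v = nablaJE cov p u v := by
  have h1 : (pullbackCov cov (fun q => q.str (FiberBundle.extend E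
      (show TangentSpace 𝓘(ℝ, E) p.pt from v) q.pt)) p u : E) =
      p.fibreLin u.2 v + conn cov p.pt (p.strE v) u.1 := by
    have h0 : p.str (FiberBundle.extend E (show TangentSpace 𝓘(ℝ, E) p.pt from v) p.pt) =
        p.strE v := by rw [FiberBundle.extend_apply_self]; rfl
    rw [pullbackCov, (hasMFDerivAt_str p v).mfderiv]
    change (trivializationAt E (TangentSpace 𝓘(ℝ, E)) p.pt).symmL ℝ p.pt (p.fibreLin u.2 v) +
      cov (FiberBundle.extend E (p.str (FiberBundle.extend E
        (show TangentSpace 𝓘(ℝ, E) p.pt from v) p.pt))) p.pt (p.dproj u) = _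
    rw [symmL_self, h0]
    exact congrArg (fun w : E => p.fibreLin u.2 v + (conn cov p.pt (p.strE v)) w) (dproj_eq p u)
  have h2 : (pullbackCov cov (fun q => FiberBundle.extend E
      (show TangentSpace 𝓘(ℝ, E) p.pt from v) q.pt) p u : E) = conn cov p.pt v u.1 := by
    rw [pullbackCov, mfderiv_extend]
    change (trivializationAt E (TangentSpace 𝓘(ℝ, E)) p.pt).symmL ℝ p.pt (0 : E) +
      cov (FiberBundle.extend E (FiberBundle.extend E
        (show TangentSpace 𝓘(ℝ, E) p.pt from v) p.pt)) p.pt (p.dproj u) = _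
    rw [symmL_self, FiberBundle.extend_apply_self]
    refine (zero_add _).trans ?_
    exact congrArg (fun w : E => (conn cov p.pt v) w) (dproj_eq p u)
  have h3 := congrArg₂ (fun a b : E => a - p.strE b) h1 h2
  refine Eq.trans h3 ?_
  simp only [nablaJE, add_sub_assoc]
  rfl

theorem unframe_mul (p : TwistorSpace E M) (k l : E →L[ℝ] E) :
    p.unframe k * p.unframe l = p.unframe (k * l) := by
  simp [unframe, mul_assoc]

theorem unframe_stdJ (p : TwistorSpace E M) : p.unframe (stdJ E) = p.strE := p.frame_spec.symm

theorem unframe_injective (p : TwistorSpace E M) : Function.Injective p.unframe := by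
  intro k l h
  simpa [unframe] using h

theorem nablaJE_anti (cov : CovariantDerivative 𝓘(ℝ, E) E (TangentSpace 𝓘(ℝ, E) : M → Type _))
    (p : TwistorSpace E M) (u : TwistorModel E) :
    nablaJE cov p u * p.strE = -(p.strE * nablaJE cov p u) := by
  have h1 : p.fibreLin u.2 * p.strE = -(p.strE * p.fibreLin u.2) := by
    have h : ((2 : ℝ) • ((u.2 : E →L[ℝ] E) * stdJ E)) * stdJ E =
        -(stdJ E * ((2 : ℝ) • ((u.2 : E →L[ℝ] E) * stdJ E))) := by
      rw [smul_mul_assoc, mul_smul_comm, ← mul_assoc, ← smul_neg, ← neg_mul, ← mem_antiEnd.1 u.2.2]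
    rw [fibreLin_apply, ← unframe_stdJ, unframe_mul, unframe_mul, h]
    simp [unframe]
  have hj := p.strE_sq
  rw [nablaJE, add_mul, mul_add, h1, sub_mul, mul_sub, mul_assoc, hj, ← mul_assoc p.strE p.strE, hj,
    mul_assoc]
  simp only [mul_neg, mul_one, neg_mul, one_mul]
  abel

theorem exists_nablaJE (cov : CovariantDerivative 𝓘(ℝ, E) E (TangentSpace 𝓘(ℝ, E) : M → Type _))
    (p : TwistorSpace E M) (e : E) {W : E →L[ℝ] E} (hW : W * p.strE = -(p.strE * W)) :
    ∃ u : TwistorModel E, u.1 = e ∧ nablaJE cov p u = W := by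
  have hC := nablaJE_anti cov p (e, 0)
  set C := nablaJE cov p (e, 0) with hCdef
  have hj := p.stdJ_sq'
  obtain ⟨k, hk⟩ : ∃ k, p.unframe k = W - C :=
    ⟨↑p.frame⁻¹ * (W - C) * p.frame, by simp [unframe, mul_assoc]⟩
  have hk' : k * stdJ E = -(stdJ E * k) := by
    apply p.unframe_injective
    have : p.unframe (-(stdJ E * k)) = -p.unframe (stdJ E * k) := by simp [unframe]
    rw [this, ← p.unframe_mul k, ← p.unframe_mul _ k, hk, unframe_stdJ, sub_mul, mul_sub, hW, hC]
    abel
  have ha : (-(2⁻¹ : ℝ)) • (k * stdJ E) ∈ antiEnd E := by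
    rw [mem_antiEnd, smul_mul_assoc, mul_smul_comm, ← smul_neg, ← mul_assoc, ← neg_mul, ← hk']
  refine ⟨(e, ⟨_, ha⟩), rfl, ?_⟩
  have h0 : p.fibreLin 0 = 0 := ContinuousLinearMap.map_zero _
  have h2 : nablaJE cov p (e, ⟨_, ha⟩) = p.fibreLin ⟨_, ha⟩ + C := by
    rw [hCdef, nablaJE, nablaJE]
    simp only [h0, zero_add]
  rw [h2, fibreLin_apply]
  have h3 : (2 : ℝ) • ((-(2⁻¹ : ℝ)) • (k * stdJ E) * stdJ E) = k := by
    rw [smul_mul_assoc, smul_smul, mul_assoc, hj]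
    simp
  simp only [h3, hk]
  abel

theorem nablaJE_inj (cov : CovariantDerivative 𝓘(ℝ, E) E (TangentSpace 𝓘(ℝ, E) : M → Type _))
    (p : TwistorSpace E M) {u w : TwistorModel E} (h1 : u.1 = w.1)
    (h2 : nablaJE cov p u = nablaJE cov p w) : u = w := by
  rw [nablaJE, nablaJE, h1] at h2
  have h3 := add_right_cancel h2
  rw [fibreLin_apply, fibreLin_apply] at h3
  have h4 := p.unframe_injective h3
  have h5 : (u.2 : E →L[ℝ] E) * stdJ E = w.2 * stdJ E := smul_right_injective _ (two_ne_zero (α := ℝ)) h4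
  have h6 := congr($h5 * stdJ E)
  rw [mul_assoc, mul_assoc, p.stdJ_sq'] at h6
  exact Prod.ext h1 (Subtype.ext (by simpa using h6))

theorem nablaJE_add (cov : CovariantDerivative 𝓘(ℝ, E) E (TangentSpace 𝓘(ℝ, E) : M → Type _))
    (p : TwistorSpace E M) (u w : TwistorModel E) :
    nablaJE cov p (u + w) = nablaJE cov p u + nablaJE cov p w := by
  have h1 : p.fibreLin (u.2 + w.2) = p.fibreLin u.2 + p.fibreLin w.2 :=
    ContinuousLinearMap.map_add _ _ _
  have h2 : (conn cov p.pt).flip (u.1 + w.1) = (conn cov p.pt).flip u.1 + (conn cov p.pt).flip w.1 :=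
    ContinuousLinearMap.map_add _ _ _
  simp only [nablaJE, Prod.fst_add, Prod.snd_add, h1, h2, add_mul, mul_add]
  abel

theorem nablaJE_smul (cov : CovariantDerivative 𝓘(ℝ, E) E (TangentSpace 𝓘(ℝ, E) : M → Type _))
    (p : TwistorSpace E M) (c : ℝ) (u : TwistorModel E) :
    nablaJE cov p (c • u) = c • nablaJE cov p u := by
  have h1 : p.fibreLin (c • u.2) = c • p.fibreLin u.2 := ContinuousLinearMap.map_smul _ _ _
  have h2 : (conn cov p.pt).flip (c • u.1) = c • (conn cov p.pt).flip u.1 :=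
    ContinuousLinearMap.map_smul _ _ _
  simp only [nablaJE, Prod.smul_fst, Prod.smul_snd, h1, h2, smul_mul_assoc, mul_smul_comm,
    smul_add, smul_sub]

theorem isTwistorStructure_iff
    (cov : CovariantDerivative 𝓘(ℝ, E) E (TangentSpace 𝓘(ℝ, E) : M → Type _))
    (J : (p : TwistorSpace E M) → TwistorModel E →L[ℝ] TwistorModel E) :
    IsTwistorStructure cov J ↔ ∀ (p : TwistorSpace E M) (u : TwistorModel E),
      (J p u).1 = p.strE u.1 ∧ nablaJE cov p (J p u) = p.strE * nablaJE cov p u := by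
  refine forall_congr' fun p => forall_congr' fun u => ?_
  refine and_congr ?_ ?_
  · rw [dproj_eq, dproj_eq]; rfl
  · rw [ContinuousLinearMap.ext_iff]
    refine forall_congr' fun v => ?_
    have h1 := nablaJ_eq cov p u v
    have h2 := nablaJ_eq cov p (J p u) v
    have h3 : p.strE (nablaJ cov p u v) = p.strE (nablaJE cov p u v) := congrArg p.strE h1
    constructor
    · intro h
      exact h2.symm.trans (h.trans h3)
    · intro h
      exact h2.trans (Eq.trans h h3.symm)

/-- A connection determines a unique almost complex structure on `J(M)`. -/
theorem existsUnique_isTwistorStructure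
    (cov : CovariantDerivative 𝓘(ℝ, E) E (TangentSpace 𝓘(ℝ, E) : M → Type _)) :
    ∃! J : (p : TwistorSpace E M) → TangentSpace 𝓘(ℝ, TwistorModel E) p →L[ℝ]
      TangentSpace 𝓘(ℝ, TwistorModel E) p, IsTwistorStructure cov J := by
  have key : ∀ (p : TwistorSpace E M) (u : TwistorModel E), ∃ w : TwistorModel E,
      w.1 = p.strE u.1 ∧ nablaJE cov p w = p.strE * nablaJE cov p u := by
    intro p u
    apply exists_nablaJE
    rw [mul_assoc, nablaJE_anti, mul_neg]
  choose F hF1 hF2 using key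
  have hfin : FiniteDimensional ℝ (E →L[ℝ] E) := inferInstance
  let J (p : TwistorSpace E M) : TwistorModel E →ₗ[ℝ] TwistorModel E :=
    { toFun := F p
      map_add' := fun u w => nablaJE_inj cov p (by simp [hF1]) (by
        rw [nablaJE_add, hF2, hF2, hF2, nablaJE_add, mul_add])
      map_smul' := fun c u => nablaJE_inj cov p (by simp [hF1]) (by
        rw [RingHom.id_apply, nablaJE_smul, hF2, hF2, nablaJE_smul, mul_smul_comm]) }
  let J' (p : TwistorSpace E M) : TwistorModel E →L[ℝ] TwistorModel E :=
    LinearMap.toContinuousLinearMap (J p)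
  refine ⟨J', ?_, ?_⟩
  · refine (isTwistorStructure_iff cov J').2 ?_
    exact fun p u => ⟨hF1 p u, hF2 p u⟩
  · intro J' hJ'
    replace hJ' := (isTwistorStructure_iff cov J').1 hJ'
    funext p
    refine ContinuousLinearMap.ext fun u => ?_
    exact nablaJE_inj cov p ((hJ' p u).1.trans (hF1 p u).symm) ((hJ' p u).2.trans (hF2 p u).symm)

/-- The almost complex structure `J^∇` on `J(M)` determined by the connection `∇`. -/
def twistorJ (cov : CovariantDerivative 𝓘(ℝ, E) E (TangentSpace 𝓘(ℝ, E) : M → Type _)) :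
    (p : TwistorSpace E M) → TangentSpace 𝓘(ℝ, TwistorModel E) p →L[ℝ]
      TangentSpace 𝓘(ℝ, TwistorModel E) p :=
  (existsUnique_isTwistorStructure cov).choose

theorem twistorJ_spec (cov : CovariantDerivative 𝓘(ℝ, E) E (TangentSpace 𝓘(ℝ, E) : M → Type _)) :
    IsTwistorStructure cov (twistorJ cov) :=
  (existsUnique_isTwistorStructure cov).choose_spec.1

theorem twistorJ_sq (cov : CovariantDerivative 𝓘(ℝ, E) E (TangentSpace 𝓘(ℝ, E) : M → Type _))
    (p : TwistorSpace E M) (u : TangentSpace 𝓘(ℝ, TwistorModel E) p) :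
    twistorJ cov p (twistorJ cov p u) = -u := by
  have hj := p.strE_sq
  have hn : ∀ u : TwistorModel E, nablaJE cov p (-u) = -nablaJE cov p u := fun u => by
    rw [← neg_one_smul ℝ, nablaJE_smul, neg_one_smul]
  have aux : ∀ J : (p : TwistorSpace E M) → TwistorModel E →L[ℝ] TwistorModel E,
      IsTwistorStructure cov J → ∀ u, J p (J p u) = -u := by
    intro J hJ u
    have h := (isTwistorStructure_iff cov J).1 hJ
    refine nablaJE_inj cov p ?_ ?_
    · rw [(h p _).1, (h p u).1]
      exact congr($hj u.1)
    · rw [(h p _).2, (h p u).2, hn, ← mul_assoc, hj, neg_one_mul]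
  exact aux _ (twistorJ_spec cov) u

end TwistorSpace
end Conn
end Twistor

namespace Twistor

section Integrable
variable {F : Type*} [NormedAddCommGroup F] [NormedSpace ℝ F]
  {N : Type*} [TopologicalSpace N] [ChartedSpace F N]

/-- The Nijenhuis expression `[JX, JY] - J[JX, Y] - J[X, JY] - [X, Y]` at `p`. -/
def nijenhuis (J : (p : N) → TangentSpace 𝓘(ℝ, F) p →L[ℝ] TangentSpace 𝓘(ℝ, F) p)
    (X Y : (p : N) → TangentSpace 𝓘(ℝ, F) p) (p : N) : TangentSpace 𝓘(ℝ, F) p :=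
  VectorField.mlieBracket 𝓘(ℝ, F) (fun q => J q (X q)) (fun q => J q (Y q)) p
    - J p (VectorField.mlieBracket 𝓘(ℝ, F) (fun q => J q (X q)) Y p)
    - J p (VectorField.mlieBracket 𝓘(ℝ, F) X (fun q => J q (Y q)) p)
    - VectorField.mlieBracket 𝓘(ℝ, F) X Y p

/-- Integrability of an almost complex structure: its Nijenhuis tensor vanishes. -/
def IsIntegrable [IsManifold 𝓘(ℝ, F) ∞ N]
    (J : (p : N) → TangentSpace 𝓘(ℝ, F) p →L[ℝ] TangentSpace 𝓘(ℝ, F) p) : Prop :=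
  ∀ (p : N) (X Y : (q : N) → TangentSpace 𝓘(ℝ, F) q),
    ContMDiffAt 𝓘(ℝ, F) (𝓘(ℝ, F).prod 𝓘(ℝ, F)) ∞
      (fun q => (⟨q, X q⟩ : TangentBundle 𝓘(ℝ, F) N)) p →
    ContMDiffAt 𝓘(ℝ, F) (𝓘(ℝ, F).prod 𝓘(ℝ, F)) ∞
      (fun q => (⟨q, Y q⟩ : TangentBundle 𝓘(ℝ, F) N)) p →
    nijenhuis J X Y p = 0

end Integrable

section Torsion
variable {E : Type*} [NormedAddCommGroup E] [NormedSpace ℝ E] [FiniteDimensional ℝ E]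
  [CompleteSpace E]
  {M : Type*} [TopologicalSpace M] [ChartedSpace E M] [IsManifold 𝓘(ℝ, E) ∞ M]

/-- The trace form `α(X) = (n - 1)⁻¹ tr (Y ↦ T(X, Y))` of the torsion, with `n = dim M`. -/
def torsionTrace (cov : CovariantDerivative 𝓘(ℝ, E) E (TangentSpace 𝓘(ℝ, E) : M → Type _))
    (x : M) (X : TangentSpace 𝓘(ℝ, E) x) : ℝ :=
  ((Module.finrank ℝ E : ℝ) - 1)⁻¹ *
    LinearMap.trace ℝ (TangentSpace 𝓘(ℝ, E) x) (cov.torsion x X).toLinearMap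

end Torsion

end Twistor

end

/-! Fix a point `p = (x, j)` of `J(M)`. The horizontal part at `p` of the Nijenhuis tensor of `J^∇`
is, up to sign, the tensor `T(jX, jY) - j T(jX, Y) - j T(X, jY) - T(X, Y)`, a multiple of the
(0,2)-part of the torsion with respect to `j` (`nijenhuis_fst`). Since `p` is arbitrary,
integrability makes this part vanish for every complex structure on every tangent space
(`torsionE_of_isIntegrable`). The vertical part of the Nijenhuis tensor, which carries curvature, is
never needed.

Two independent consequences finish the proof. The first is linear algebra (`eq_trace_type`):
complex structures that exchange basis vectors in pairs, with free weights, show that `T(b x, b y)`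
lies in the span of `b x` and `b y`, and that its `b x`-coefficient depends on `y` alone. This is
the trace form. The second is that subtracting `T/2` from `∇` changes the covariant differential of
the tautological section by a commutator `[B_X, j]`; the condition `[B_{jX}, j] = j [B_X, j]` for
not changing the almost complex structure is the vanishing of the (0,2)-part
(`twistorJ_symmetrization`).

The Lie brackets require `J^∇` near `p`, not only at `p`. In coordinates with connection form `Γ`
and with `k(y)` the matrix of the tautological structure, the covariant differential is `dk + [Γ,
k]` (`nablaJE_toPoint`), so the defining conditions can be solved for `J^∇` explicitly (`coordJ`).
Its horizontal component on a constant field `u` is just `k(y) u.1`, whose derivative is purely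
vertical. Smoothness of `∇` enters through `Γ`, both for differentiating this expression and for the
smoothness of the new connection. -/

noncomputable section

set_option linter.unusedSectionVars false

namespace Twistor

/-! ### Linear algebra: tensors without (0,2)-part for every complex structure. -/

section TraceType
variable {V : Type*} [AddCommGroup V] [Module ℝ V] {ι : Type*} [DecidableEq ι]

/-- The endomorphism exchanging the two members of each pair of basis vectors, with weights. -/
def pairing (b : Module.Basis (ι × Bool) ℝ V) (w : ι × Bool → ℝ) : V →ₗ[ℝ] V :=
  b.constr ℝ fun x => w x • b (x.1, !x.2)

theorem pairing_basis (b : Module.Basis (ι × Bool) ℝ V) (w : ι × Bool → ℝ) (x : ι × Bool) :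
    pairing b w (b x) = w x • b (x.1, !x.2) := by
  rw [pairing, Module.Basis.constr_basis]

theorem pairing_sq (b : Module.Basis (ι × Bool) ℝ V) {w : ι × Bool → ℝ}
    (hw : ∀ x, w x * w (x.1, !x.2) = -1) (v : V) : pairing b w (pairing b w v) = -v := by
  have h : pairing b w ∘ₗ pairing b w = -LinearMap.id := by
    refine b.ext fun x => ?_
    simp only [LinearMap.comp_apply, pairing_basis, map_smul, smul_smul, hw, Bool.not_not]
    simp
  exact congr($h v)

theorem repr_pairing (b : Module.Basis (ι × Bool) ℝ V) (w : ι × Bool → ℝ) (v : V) (x : ι × Bool) :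
    b.repr (pairing b w v) (x.1, !x.2) = w x * b.repr v x := by
  have h : b.coord (x.1, !x.2) ∘ₗ pairing b w = w x • b.coord x := by
    refine b.ext fun y => ?_
    simp only [LinearMap.comp_apply, pairing_basis, map_smul, LinearMap.smul_apply,
      Module.Basis.coord_apply, Module.Basis.repr_self, smul_eq_mul]
    by_cases hxy : y = x
    · subst hxy; simp
    · have h' : ¬ (y.1, !y.2) = (x.1, !x.2) := by
        intro h
        apply hxy
        simp only [Prod.mk.injEq, Bool.not_inj_iff] at h
        exact Prod.ext h.1 h.2
      rw [Finsupp.single_eq_of_ne (Ne.symm h'), Finsupp.single_eq_of_ne (Ne.symm hxy)]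
      simp
  exact congr($h v)

/-- A pair of weights `u`, `v` on two given pairs of basis vectors. -/
def pairWeight (i k : ι) (ε δ : Bool) (u v : ℝ) (x : ι × Bool) : ℝ :=
  if x.1 = i then (if x.2 = ε then u else -u⁻¹)
  else if x.1 = k then (if x.2 = δ then v else -v⁻¹)
  else if x.2 then 1 else -1

theorem pairWeight_mul (i k : ι) (ε δ : Bool) {u v : ℝ} (hu : u ≠ 0) (hv : v ≠ 0) (x : ι × Bool) :
    pairWeight i k ε δ u v x * pairWeight i k ε δ u v (x.1, !x.2) = -1 := by
  obtain ⟨l, β⟩ := x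
  unfold pairWeight
  by_cases h1 : l = i
  · cases β <;> cases ε <;> simp [h1, hu]
  · by_cases h2 : l = k
    · subst h2; cases β <;> cases δ <;> simp [h1, hv]
    · cases β <;> simp [h1, h2]

variable {T : V →ₗ[ℝ] V →ₗ[ℝ] V}

/-- Give `b (i, ε)` weight `u` and `b (k, δ)` weight `v`. The coefficient of `hJ` along `b (i, !ε)`
is then `u v A - u² B - u v C - D = 0`, where `A`, `B`, `C`, `D` do not depend on the weights. As
`u` and `v` are arbitrary nonzero reals, the monomials separate: `A = C` and `B = D = 0`. -/
theorem pairing_coefficients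
    (hJ : ∀ j : V →ₗ[ℝ] V, (∀ v, j (j v) = -v) → ∀ X Y,
      T (j X) (j Y) - j (T (j X) Y) - j (T X (j Y)) - T X Y = 0)
    (b : Module.Basis (ι × Bool) ℝ V) {i k : ι} (hik : i ≠ k) (ε δ : Bool) :
    b.repr (T (b (i, ε)) (b (k, δ))) (i, !ε) = 0 ∧
      b.repr (T (b (i, !ε)) (b (k, !δ))) (i, !ε) = b.repr (T (b (i, ε)) (b (k, !δ))) (i, ε) := by
  have key : ∀ u v : ℝ, u ≠ 0 → v ≠ 0 →
      u * v * b.repr (T (b (i, !ε)) (b (k, !δ))) (i, !ε)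
        - u * (u * b.repr (T (b (i, !ε)) (b (k, δ))) (i, ε))
        - u * (v * b.repr (T (b (i, ε)) (b (k, !δ))) (i, ε))
        - b.repr (T (b (i, ε)) (b (k, δ))) (i, !ε) = 0 := by
    intro u v hu hv
    have h := hJ (pairing b (pairWeight i k ε δ u v))
      (pairing_sq b (pairWeight_mul i k ε δ hu hv)) (b (i, ε)) (b (k, δ))
    have h' := congr(b.repr $h (i, !ε))
    simp only [map_sub, Finsupp.sub_apply, map_zero, Finsupp.zero_apply] at h'
    rw [repr_pairing b _ _ (i, ε), repr_pairing b _ _ (i, ε)] at h'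
    have w1 : pairWeight i k ε δ u v (i, ε) = u := by simp [pairWeight]
    have w2 : pairWeight i k ε δ u v (k, δ) = v := by simp [pairWeight, hik.symm]
    simp only [pairing_basis, w1, w2, map_smul, LinearMap.smul_apply, Finsupp.smul_apply,
      smul_eq_mul] at h'
    linarith
  -- The first two choices give `A = C` and `B + D = 0`; the third gives `4 B + D = 0`.
  have h1 := key 1 1 (by norm_num) (by norm_num)
  have h2 := key 1 (-1) (by norm_num) (by norm_num)
  have h3 := key 2 1 (by norm_num) (by norm_num)
  constructor <;> linarith

/-- The pairing of the basis vectors is at our disposal: after a permutation of the basis, `z`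
becomes the partner of `x`, and `pairing_coefficients` applies. -/
theorem basis_coefficients
    (hJ : ∀ j : V →ₗ[ℝ] V, (∀ v, j (j v) = -v) → ∀ X Y,
      T (j X) (j Y) - j (T (j X) Y) - j (T X (j Y)) - T X Y = 0)
    (b : Module.Basis (ι × Bool) ℝ V) {x y z : ι × Bool} (hxy : x ≠ y) (hxz : x ≠ z)
    (hyz : y ≠ z) :
    b.repr (T (b x) (b y)) z = 0 ∧ b.repr (T (b z) (b y)) z = b.repr (T (b x) (b y)) x := by
  let σ : Equiv.Perm (ι × Bool) := Equiv.swap (x.1, !x.2) z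
  have hx : x ≠ (x.1, !x.2) := fun h => by simpa using congrArg Prod.snd h
  have hσx : σ x = x := Equiv.swap_apply_of_ne_of_ne hx hxz
  have hσz : σ z = (x.1, !x.2) := Equiv.swap_apply_right _ _
  -- `σ y` is neither `x` nor the partner of `x`, so it belongs to another pair.
  have hσy : x.1 ≠ (σ y).1 := by
    intro h
    have h1 : σ y ≠ x := by
      rw [← hσx]; exact fun h => hxy (σ.injective h).symm
    have h2 : σ y ≠ (x.1, !x.2) := by
      rw [← hσz]; exact fun h => hyz (σ.injective h)
    by_cases h3 : (σ y).2 = x.2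
    · exact h1 (Prod.ext h.symm h3)
    · exact h2 (Prod.ext h.symm (Bool.eq_not_iff.2 h3))
  have hb : ∀ w, b.reindex σ (σ w) = b w := fun w => by simp
  have hr : ∀ v w, (b.reindex σ).repr v (σ w) = b.repr v w := fun v w => by simp
  have h1 := (pairing_coefficients hJ (b.reindex σ) hσy x.2 (σ y).2).1
  -- The second flag is negated so that the partner occurring in the conclusion is `σ y` itself.
  have h2 := (pairing_coefficients hJ (b.reindex σ) hσy x.2 (!(σ y).2)).2
  simp only [Bool.not_not, Prod.mk.eta] at h1 h2
  rw [← hσz] at h1 h2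
  rw [hb, hr] at h1
  rw [hb, hr, hb] at h2
  have hbx : b.reindex σ x = b x := by rw [← hb x, hσx]
  have hrx : ∀ v, (b.reindex σ).repr v x = b.repr v x := fun v => by rw [← hr v x, hσx]
  rw [hbx] at h1
  rw [hbx, hrx] at h2
  exact ⟨h1, h2⟩

/-- A torsion tensor of type `(1,1)` and `(2,0)` for all complex structures is of trace type. -/
theorem eq_trace_type [FiniteDimensional ℝ V] (hV : Even (Module.finrank ℝ V))
    (hT : ∀ X, T X X = 0)
    (hJ : ∀ j : V →ₗ[ℝ] V, (∀ v, j (j v) = -v) → ∀ X Y,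
      T (j X) (j Y) - j (T (j X) Y) - j (T X (j Y)) - T X Y = 0) (X Y : V) :
    T X Y = (((Module.finrank ℝ V : ℝ) - 1)⁻¹ * LinearMap.trace ℝ V (T X)) • Y -
      (((Module.finrank ℝ V : ℝ) - 1)⁻¹ * LinearMap.trace ℝ V (T Y)) • X := by
  obtain ⟨m, hm⟩ := hV
  let b : Module.Basis (Fin m × Bool) ℝ V := (Module.finBasis ℝ V).reindex
    (Fintype.equivOfCardEq (by simp [hm]; ring))
  -- Evenness rules out dimension 1, the only one in which the normalizing factor degenerates.
  have hn : (Module.finrank ℝ V : ℝ) - 1 ≠ 0 := by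
    intro h
    have h1 : (Module.finrank ℝ V : ℝ) = 1 := by linarith
    have h2 : Module.finrank ℝ V = 1 := by exact_mod_cast h1
    omega
  have hanti : ∀ X Y, T X Y = -T Y X := fun X Y => by
    have h := hT (X + Y)
    simp only [map_add, LinearMap.add_apply, hT, zero_add, add_zero] at h
    exact eq_neg_of_add_eq_zero_right h
  -- The matrix of `T (b y)` has diagonal entry 0 at `y`, and by `basis_coefficients` its other `n -
  -- 1` diagonal entries coincide, so the normalized trace is any one of them.
  have htr : ∀ x y, x ≠ y → ((Module.finrank ℝ V : ℝ) - 1)⁻¹ * LinearMap.trace ℝ V (T (b y)) =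
      b.repr (T (b y) (b x)) x := by
    intro x y hxy
    rw [inv_mul_eq_iff_eq_mul₀ hn, LinearMap.trace_eq_matrix_trace ℝ b, Matrix.trace]
    simp only [Matrix.diag_apply, LinearMap.toMatrix_apply]
    rw [← Finset.add_sum_erase _ _ (Finset.mem_univ y), hT, map_zero, Finsupp.zero_apply, zero_add,
      Finset.sum_congr rfl (g := fun _ => b.repr (T (b y) (b x)) x), Finset.sum_const,
      Finset.card_erase_of_mem (Finset.mem_univ y), Finset.card_univ,
      ← Module.finrank_eq_card_basis b, nsmul_eq_mul, Nat.cast_sub, Nat.cast_one]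
    · have : Nonempty (Fin m × Bool) := ⟨x⟩
      rw [Module.finrank_eq_card_basis b]
      exact Fintype.card_pos
    · intro z hz
      have hzy : z ≠ y := Finset.ne_of_mem_erase hz
      by_cases hzx : z = x
      · rw [hzx]
      · have := (basis_coefficients hJ b hxy (Ne.symm hzx) hzy.symm).2
        rw [hanti (b y), hanti (b y) (b x), map_neg, map_neg, Finsupp.neg_apply, Finsupp.neg_apply,
          this]
  let α : V →ₗ[ℝ] ℝ := ((Module.finrank ℝ V : ℝ) - 1)⁻¹ • (LinearMap.trace ℝ V ∘ₗ T)
  suffices T = α.smulRight LinearMap.id - (α.smulRight LinearMap.id).flip by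
    have := congr($this X Y)
    simpa [α] using this
  refine b.ext fun x => b.ext fun y => ?_
  simp only [LinearMap.sub_apply, LinearMap.smulRight_apply, LinearMap.flip_apply,
    LinearMap.smul_apply, LinearMap.id_apply]
  by_cases hxy : x = y
  · subst hxy; simp [hT]
  · have h1 : α (b x) = b.repr (T (b x) (b y)) y := htr y x (Ne.symm hxy)
    have h2 : α (b y) = b.repr (T (b y) (b x)) x := htr x y hxy
    rw [h1, h2]
    -- Along `b y` and `b x` the coefficients are the traces just found; along any third basis
    -- vector both sides vanish.
    refine b.ext_elem fun z => ?_
    simp only [map_sub, map_smul, Finsupp.sub_apply, Finsupp.smul_apply, Module.Basis.repr_self,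
      smul_eq_mul]
    by_cases hzy : z = y
    · subst hzy; simp [Finsupp.single_eq_of_ne (Ne.symm hxy)]
    · by_cases hzx : z = x
      · subst hzx
        rw [hanti (b y)]
        simp [Finsupp.single_eq_of_ne hxy]
      · rw [(basis_coefficients hJ b hxy (Ne.symm hzx) (Ne.symm hzy)).1,
          Finsupp.single_eq_of_ne hzy, Finsupp.single_eq_of_ne hzx]
        simp

end TraceType
end Twistor

namespace Twistor

/-! ### Coordinate changes of tangent vectors, and Lie brackets in a chart. -/

section Frame
variable {E : Type*} [NormedAddCommGroup E] [NormedSpace ℝ E] [FiniteDimensional ℝ E]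
  {M : Type*} [TopologicalSpace M] [ChartedSpace E M] [IsManifold 𝓘(ℝ, E) ∞ M]

/-- `T_x M` is the model space read in the preferred chart at `x`. Thus `tangentCoordChange _ x x₀
x` takes a tangent vector at `x` to its components in the chart at `x₀`, and `tangentCoordChange _
x₀ x x` takes components back to the vector. -/
theorem tcc_mul_symm {x₀ x : M} (h : x ∈ (chartAt E x₀).source) :
    tangentCoordChange 𝓘(ℝ, E) x x₀ x * tangentCoordChange 𝓘(ℝ, E) x₀ x x = 1 := by
  rw [tcc_mul h (mem_chart_source E x) h, tcc_self h]

theorem tcc_symm_mul {x₀ x : M} (h : x ∈ (chartAt E x₀).source) :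
    tangentCoordChange 𝓘(ℝ, E) x₀ x x * tangentCoordChange 𝓘(ℝ, E) x x₀ x = 1 := by
  rw [tcc_mul (mem_chart_source E x) h (mem_chart_source E x), tcc_self (mem_chart_source E x)]

theorem tcc_symm_apply {x₀ x : M} (h : x ∈ (chartAt E x₀).source) (v : E) :
    tangentCoordChange 𝓘(ℝ, E) x x₀ x (tangentCoordChange 𝓘(ℝ, E) x₀ x x v) = v :=
  congr($(tcc_mul_symm h) v)

theorem tcc_apply_symm {x₀ x : M} (h : x ∈ (chartAt E x₀).source) (v : E) :
    tangentCoordChange 𝓘(ℝ, E) x₀ x x (tangentCoordChange 𝓘(ℝ, E) x x₀ x v) = v :=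
  congr($(tcc_symm_mul h) v)

theorem mfderiv_chart_symm {p : M} {y : E} (hy : y ∈ (chartAt E p).target) :
    mfderivWithin 𝓘(ℝ, E) 𝓘(ℝ, E) (extChartAt 𝓘(ℝ, E) p).symm (range 𝓘(ℝ, E)) y =
      tangentCoordChange 𝓘(ℝ, E) p ((chartAt E p).symm y) ((chartAt E p).symm y) := by
  have hs : (chartAt E p).symm y ∈ (chartAt E p).source := (chartAt E p).map_target hy
  have h := TangentBundle.symmL_trivializationAt (𝕜 := ℝ) (I := 𝓘(ℝ, E)) hs
  rw [TangentBundle.symmL_trivializationAt_eq_core hs] at h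
  have h2 : extChartAt 𝓘(ℝ, E) p ((chartAt E p).symm y) = y := by
    simpa using (chartAt E p).right_inv hy
  rw [h2] at h
  exact h.symm

theorem hasFDerivAt_trans {x₀ x z : M} (h₀ : z ∈ (chartAt E x₀).source)
    (h : z ∈ (chartAt E x).source) :
    HasFDerivAt (fun e => chartAt E x ((chartAt E x₀).symm e)) (tangentCoordChange 𝓘(ℝ, E) x₀ x z)
      (chartAt E x₀ z) := by
  have := hasFDerivWithinAt_tangentCoordChange (I := 𝓘(ℝ, E)) (x := x₀) (y := x) (z := z)
    (by simp [h₀, h])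
  simpa using! this

/-- The Lie bracket of two vector fields in terms of their components in the preferred chart. -/
theorem mlieBracket_eq_lieBracket {p : M} {V W : (q : M) → TangentSpace 𝓘(ℝ, E) q} {v w : E → E}
    (hV : ∀ᶠ y in 𝓝 (chartAt E p p), V ((chartAt E p).symm y) =
      tangentCoordChange 𝓘(ℝ, E) p ((chartAt E p).symm y) ((chartAt E p).symm y) (v y))
    (hW : ∀ᶠ y in 𝓝 (chartAt E p p), W ((chartAt E p).symm y) =
      tangentCoordChange 𝓘(ℝ, E) p ((chartAt E p).symm y) ((chartAt E p).symm y) (w y)) :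
    (VectorField.mlieBracket 𝓘(ℝ, E) V W p : E) =
      VectorField.lieBracket ℝ v w (chartAt E p p) := by
  -- The manifold bracket is the flat bracket of the pull-backs along the inverse chart, and such a
  -- pull-back is the component function.
  have key : ∀ {V : (q : M) → TangentSpace 𝓘(ℝ, E) q} {v : E → E},
      (∀ᶠ y in 𝓝 (chartAt E p p), V ((chartAt E p).symm y) =
        tangentCoordChange 𝓘(ℝ, E) p ((chartAt E p).symm y) ((chartAt E p).symm y) (v y)) →
      VectorField.mpullbackWithin 𝓘(ℝ, E) 𝓘(ℝ, E) (extChartAt 𝓘(ℝ, E) p).symm V (range 𝓘(ℝ, E))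
        =ᶠ[𝓝 (chartAt E p p)] v := by
    intro V v h
    filter_upwards [h, (chartAt E p).open_target.mem_nhds (mem_chart_target E p)] with y hy hy'
    have hs : (chartAt E p).symm y ∈ (chartAt E p).source := (chartAt E p).map_target hy'
    have hinv : ContinuousLinearMap.inverse
        (tangentCoordChange 𝓘(ℝ, E) p ((chartAt E p).symm y) ((chartAt E p).symm y)) =
        tangentCoordChange 𝓘(ℝ, E) ((chartAt E p).symm y) p ((chartAt E p).symm y) :=
      ContinuousLinearMap.inverse_eq (tcc_symm_mul hs) (tcc_mul_symm hs)
    have h1 : (extChartAt 𝓘(ℝ, E) p).symm y = (chartAt E p).symm y := by simp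
    have h2 := mfderiv_chart_symm hy'
    rw [VectorField.mpullbackWithin_apply, h2]
    have h3 : V ((extChartAt 𝓘(ℝ, E) p).symm y) =
      tangentCoordChange 𝓘(ℝ, E) p ((chartAt E p).symm y) ((chartAt E p).symm y) (v y) := hy
    rw [h3]
    refine (congr($hinv _)).trans ?_
    exact tcc_symm_apply hs (v y)
  rw [← VectorField.mlieBracketWithin_univ, VectorField.mlieBracketWithin_apply]
  have e : range 𝓘(ℝ, E) = univ := by simp
  have h := Filter.EventuallyEq.lieBracketWithin_vectorField_eq (𝕜 := ℝ) (s := univ)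
    (x := chartAt E p p)
    (by simpa using key hV) (key hV).self_of_nhds (by simpa using key hW) (key hW).self_of_nhds
  rw [VectorField.lieBracketWithin_univ] at h
  -- The result is carried back to `T_p M` by the inverse differential of the chart at its own
  -- centre, which is the identity.
  refine Eq.trans (congrArg (fun L : E →L[ℝ] E => ContinuousLinearMap.inverse L _)
    (mfderiv_extChartAt_self (I := 𝓘(ℝ, E)) (x := p))) ?_
  refine (congr($(ContinuousLinearMap.inverse_id (R := ℝ) (M := E)) _)).trans ?_
  simp only [preimage_univ, univ_inter]
  refine Eq.trans ?_ h
  rw [e]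
  rfl

theorem extend_chart_symm {p : M} {y : E} (hy : y ∈ (chartAt E p).target) (v : E) :
    FiberBundle.extend E (show TangentSpace 𝓘(ℝ, E) p from v) ((chartAt E p).symm y) =
      tangentCoordChange 𝓘(ℝ, E) p ((chartAt E p).symm y) ((chartAt E p).symm y) v :=
  TwistorSpace.extend_apply ((chartAt E p).map_target hy) v

end Frame
end Twistor

namespace Twistor

/-! ### The connection form in a chart and its transformation law. -/

section Christoffel
variable {E : Type*} [NormedAddCommGroup E] [NormedSpace ℝ E] [FiniteDimensional ℝ E]
  {M : Type*} [TopologicalSpace M] [ChartedSpace E M] [IsManifold 𝓘(ℝ, E) ∞ M]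

/-- The coordinate vector field of the chart at `x₀` with constant components `v`. -/
def coordField (x₀ : M) (v : E) : (x : M) → TangentSpace 𝓘(ℝ, E) x :=
  FiberBundle.extend E (show TangentSpace 𝓘(ℝ, E) x₀ from v)

theorem coordField_apply {x₀ x : M} (h : x ∈ (chartAt E x₀).source) (v : E) :
    coordField x₀ v x = tangentCoordChange 𝓘(ℝ, E) x₀ x x v :=
  TwistorSpace.extend_apply h v

theorem contMDiffAt_section_of_coord {x₀ x : M} (h : x ∈ (chartAt E x₀).source)
    {σ : (x : M) → TangentSpace 𝓘(ℝ, E) x} {s : M → E}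
    (hσ : ∀ᶠ y in 𝓝 x, σ y = tangentCoordChange 𝓘(ℝ, E) x₀ y y (s y))
    (hs : ContMDiffAt 𝓘(ℝ, E) 𝓘(ℝ, E) ∞ s x) :
    ContMDiffAt 𝓘(ℝ, E) (𝓘(ℝ, E).prod 𝓘(ℝ, E)) ∞
      (fun y => (⟨y, σ y⟩ : TangentBundle 𝓘(ℝ, E) M)) x := by
  rw [(trivializationAt E (TangentSpace 𝓘(ℝ, E)) x₀).contMDiffAt_section_iff (by simpa using h)]
  refine hs.congr_of_eventuallyEq ?_
  filter_upwards [hσ, (chartAt E x₀).open_source.mem_nhds h] with y hy hy'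
  rw [TwistorSpace.triv_apply, hy]
  exact tcc_symm_apply hy' (s y)

theorem contMDiffAt_coordField {x₀ x : M} (h : x ∈ (chartAt E x₀).source) (v : E) :
    ContMDiffAt 𝓘(ℝ, E) (𝓘(ℝ, E).prod 𝓘(ℝ, E)) ∞
      (fun y => (⟨y, coordField x₀ v y⟩ : TangentBundle 𝓘(ℝ, E) M)) x := by
  refine contMDiffAt_section_of_coord h ?_ (contMDiffAt_const (c := v))
  filter_upwards [(chartAt E x₀).open_source.mem_nhds h] with y hy
  exact coordField_apply hy v

theorem mdifferentiableAt_coordField {x₀ x : M} (h : x ∈ (chartAt E x₀).source) (v : E) :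
    MDifferentiableAt 𝓘(ℝ, E) (𝓘(ℝ, E).prod 𝓘(ℝ, E))
      (fun y => (⟨y, coordField x₀ v y⟩ : TangentBundle 𝓘(ℝ, E) M)) x :=
  (contMDiffAt_coordField h v).mdifferentiableAt (by simp)

variable (cov : CovariantDerivative 𝓘(ℝ, E) E (TangentSpace 𝓘(ℝ, E) : M → Type _))

/-- The endomorphism `v ↦ ∇_v σ` of `T_x M`, as an endomorphism of the model space. -/
def covE (σ : (x : M) → TangentSpace 𝓘(ℝ, E) x) (x : M) : E →L[ℝ] E := cov σ x

/-- `∇ σ` at `x` in the chart at `x₀`. -/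
def covCoord (x₀ : M) (σ : (x : M) → TangentSpace 𝓘(ℝ, E) x) (x : M) : E →L[ℝ] E :=
  toCoord x₀ x (covE cov σ x)

/-- The connection form at `x` in the frame of the chart at `x₀`: `christoffel cov x₀ x v e` is the
coordinate expression of the derivative in direction `e` of the coordinate field `v`. -/
def christoffel (x₀ x : M) : E →L[ℝ] E →L[ℝ] E :=
  ∑ i, (LinearMap.toContinuousLinearMap ((Module.finBasis ℝ E).coord i)).smulRight
    (covCoord cov x₀ (coordField x₀ (Module.finBasis ℝ E i)) x)

theorem cov_sum {ι : Type*} (S : Finset ι) (σ : ι → (x : M) → TangentSpace 𝓘(ℝ, E) x) (x : M)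
    (hσ : ∀ i, MDifferentiableAt 𝓘(ℝ, E) (𝓘(ℝ, E).prod 𝓘(ℝ, E))
      (fun y => (⟨y, σ i y⟩ : TangentBundle 𝓘(ℝ, E) M)) x) :
    cov (fun y => ∑ i ∈ S, σ i y) x = ∑ i ∈ S, cov (σ i) x := by
  classical
  induction S using Finset.induction_on with
  | empty =>
    simp only [Finset.sum_empty]
    exact congrFun cov.zero x
  | insert a S ha ih =>
    simp only [Finset.sum_insert ha]
    rw [← ih]
    exact cov.isCovariantDerivativeOnUniv.add (hσ a) (.sum_section fun i _ => hσ i)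

theorem mfderiv_comp_chart {F : Type*} [NormedAddCommGroup F] [NormedSpace ℝ F] {x₀ x : M}
    (h : x ∈ (chartAt E x₀).source) {g : E → F} (hg : DifferentiableAt ℝ g (chartAt E x₀ x)) :
    HasMFDerivAt 𝓘(ℝ, E) 𝓘(ℝ, F) (fun y => g (chartAt E x₀ y)) x
      ((fderiv ℝ g (chartAt E x₀ x)).comp (tangentCoordChange 𝓘(ℝ, E) x x₀ x : E →L[ℝ] E)) := by
  have h1 := hasMFDerivAt_extChartAt (I := 𝓘(ℝ, E)) h
  have h2 := TangentBundle.continuousLinearMapAt_trivializationAt (𝕜 := ℝ) (I := 𝓘(ℝ, E)) h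
  rw [TangentBundle.continuousLinearMapAt_trivializationAt_eq_core h] at h2
  have h3 : mfderiv 𝓘(ℝ, E) 𝓘(ℝ, E) (extChartAt 𝓘(ℝ, E) x₀) x = mfderiv 𝓘(ℝ, E) 𝓘(ℝ, E) (chartAt E x₀) x :=
    h1.mfderiv
  rw [← h3, ← h2] at h1
  have h4 : extChartAt 𝓘(ℝ, E) x₀ x = chartAt E x₀ x := by simp
  have h5 : HasMFDerivAt 𝓘(ℝ, E) 𝓘(ℝ, F) g (extChartAt 𝓘(ℝ, E) x₀ x)
      (fderiv ℝ g (chartAt E x₀ x)) := by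
    rw [h4]; exact hg.hasFDerivAt.hasMFDerivAt
  have h6 := h5.comp x h1
  exact h6

/-- The covariant derivative of a section in terms of its components in a chart. -/
theorem covE_eq {x₀ x : M} (h : x ∈ (chartAt E x₀).source)
    {σ : (x : M) → TangentSpace 𝓘(ℝ, E) x} {s : E → E}
    (hs : DifferentiableAt ℝ s (chartAt E x₀ x))
    (hσ : ∀ᶠ y in 𝓝 x, σ y = tangentCoordChange 𝓘(ℝ, E) x₀ y y (s (chartAt E x₀ y))) :
    covCoord cov x₀ σ x = fderiv ℝ s (chartAt E x₀ x) + christoffel cov x₀ x (s (chartAt E x₀ x)) := by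
  let b := Module.finBasis ℝ E
  let c := fun i => LinearMap.toContinuousLinearMap (b.coord i)
  let g : Fin (Module.finrank ℝ E) → M → ℝ := fun i y => c i (s (chartAt E x₀ y))
  have hgd : ∀ i, HasMFDerivAt 𝓘(ℝ, E) 𝓘(ℝ, ℝ) (g i) x
      (((c i).comp (fderiv ℝ s (chartAt E x₀ x))).comp
        (tangentCoordChange 𝓘(ℝ, E) x x₀ x : E →L[ℝ] E)) := fun i => by
    have h1 : HasFDerivAt (fun y => c i (s y)) ((c i).comp (fderiv ℝ s (chartAt E x₀ x)))
        (chartAt E x₀ x) := (c i).hasFDerivAt.comp _ hs.hasFDerivAt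
    have := mfderiv_comp_chart h h1.differentiableAt
    rw [h1.fderiv] at this
    exact this
  have hf : ∀ i, MDifferentiableAt 𝓘(ℝ, E) (𝓘(ℝ, E).prod 𝓘(ℝ, E))
      (fun y => (⟨y, (g i • coordField x₀ (b i)) y⟩ : TangentBundle 𝓘(ℝ, E) M)) x := fun i =>
    (hgd i).mdifferentiableAt.smul_section (mdifferentiableAt_coordField h (b i))
  -- Near `x` the section is a combination of coordinate fields with differentiable coefficients;
  -- `∇` is local, so only this expansion matters.
  have heq : ∀ᶠ y in 𝓝 x, σ y = ∑ i, (g i • coordField x₀ (b i)) y := by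
    filter_upwards [hσ, (chartAt E x₀).open_source.mem_nhds h] with y hy hy'
    rw [hy]
    have h1 : ∀ i, (g i • coordField x₀ (b i)) y =
        tangentCoordChange 𝓘(ℝ, E) x₀ y y (g i y • b i) := fun i => by
      rw [map_smul]
      exact congrArg (fun w : E => g i y • w) (coordField_apply hy' (b i))
    simp only [h1]
    refine (congrArg _ (b.sum_repr (s (chartAt E x₀ y))).symm).trans ?_
    exact map_sum (tangentCoordChange 𝓘(ℝ, E) x₀ y y) _ _
  have hS := MDifferentiableAt.sum_section (s := Finset.univ) fun i _ => hf i
  have hσd : MDifferentiableAt 𝓘(ℝ, E) (𝓘(ℝ, E).prod 𝓘(ℝ, E))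
      (fun y => (⟨y, σ y⟩ : TangentBundle 𝓘(ℝ, E) M)) x :=
    hS.congr_of_eventuallyEq (heq.mono fun y hy => by simp only [hy])
  have h1 : cov σ x = ∑ i, cov (g i • coordField x₀ (b i)) x :=
    (cov.isCovariantDerivativeOnUniv.congr_of_eventuallyEq hσd hS Filter.univ_mem heq).trans
      (cov_sum cov Finset.univ _ x hf)
  -- Leibniz rule: the derivatives of the coefficients add up to the derivative of `s`, the
  -- remaining terms to the connection form.
  have h2 : ∀ i, (covE cov (g i • coordField x₀ (b i)) x : E →L[ℝ] E) =
      g i x • covE cov (coordField x₀ (b i)) x +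
      (((c i).comp (fderiv ℝ s (chartAt E x₀ x))).comp
        (tangentCoordChange 𝓘(ℝ, E) x x₀ x : E →L[ℝ] E)).smulRight
        (tangentCoordChange 𝓘(ℝ, E) x₀ x x (b i)) := fun i => by
    have := cov.isCovariantDerivativeOnUniv.leibniz (mdifferentiableAt_coordField h (b i))
      (hgd i).mdifferentiableAt
    refine this.trans ?_
    have h3 : mvfderiv 𝓘(ℝ, E) (g i) x = ((c i).comp (fderiv ℝ s (chartAt E x₀ x))).comp
        (tangentCoordChange 𝓘(ℝ, E) x x₀ x : E →L[ℝ] E) := by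
      rw [mvfderiv, (hgd i).mfderiv]; rfl
    rw [h3]
    have h4 := coordField_apply h (b i)
    rw [h4]
    rfl
  have h3 : covE cov σ x = ∑ i, covE cov (g i • coordField x₀ (b i)) x := h1
  rw [covCoord, h3]
  simp only [h2]
  refine ContinuousLinearMap.ext fun e => ?_
  rw [toCoord, christoffel]
  simp only [mul_apply_eq_comp, sum_apply, map_sum, add_apply, smul_apply,
    ContinuousLinearMap.smulRight_apply, ContinuousLinearMap.comp_apply, tcc_symm_apply h, map_add,
    map_smul, Finset.sum_add_distrib]
  rw [add_comm]
  congr 1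
  exact b.sum_repr _

theorem conn_eq (x : M) (v : E) : TwistorSpace.conn cov x v = covE cov (coordField x v) x := rfl

/-- `contDiffOn_tcc` gives smoothness in the chart at `x`; composition with the transition map gives
it in the chart at `x₀`. -/
theorem contDiffAt_tcc_symm {x₀ x : M} (h : x ∈ (chartAt E x₀).source) :
    ContDiffAt ℝ ∞ (fun y => tangentCoordChange 𝓘(ℝ, E) x x₀ ((chartAt E x₀).symm y))
      (chartAt E x₀ x) := by
  have hsrc : chartAt E x₀ x ∈ ((chartAt E x₀).symm ≫ₕ chartAt E x).source := by
    simp [h]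
  have hc := ((TwistorSpace.contDiffOn_trans_base x₀ x).contDiffAt
    (((chartAt E x₀).symm ≫ₕ chartAt E x).open_source.mem_nhds hsrc))
  have hsrc' : chartAt E x x ∈ ((chartAt E x).symm ≫ₕ chartAt E x₀).source := by
    simp [h]
  have hd := ((TwistorSpace.contDiffOn_tcc x x₀).contDiffAt
    (((chartAt E x).symm ≫ₕ chartAt E x₀).open_source.mem_nhds hsrc'))
  have hd' : ContDiffAt ℝ ∞ (fun e => tangentCoordChange 𝓘(ℝ, E) x x₀ ((chartAt E x).symm e))
      (((chartAt E x₀).symm ≫ₕ chartAt E x) (chartAt E x₀ x)) := by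
    simpa [h] using hd
  refine (hd'.comp _ hc).congr_of_eventuallyEq ?_
  filter_upwards [((chartAt E x₀).symm ≫ₕ chartAt E x).open_source.mem_nhds hsrc] with y hy
  simp at hy
  simp [hy]

/-- The transformation law of the connection form. -/
theorem conn_eq_christoffel {x₀ x : M} (h : x ∈ (chartAt E x₀).source) (v e : E) :
    tangentCoordChange 𝓘(ℝ, E) x x₀ x
      (TwistorSpace.conn cov x v (tangentCoordChange 𝓘(ℝ, E) x₀ x x e)) =
    fderiv ℝ (fun y => tangentCoordChange 𝓘(ℝ, E) x x₀ ((chartAt E x₀).symm y)) (chartAt E x₀ x) e v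
      + christoffel cov x₀ x (tangentCoordChange 𝓘(ℝ, E) x x₀ x v) e := by
  have hd := (contDiffAt_tcc_symm h).differentiableAt (by simp)
  have hd' := (ContinuousLinearMap.apply ℝ E v).hasFDerivAt.comp _ hd.hasFDerivAt
  have hx := mem_chart_source E x
  have h0 := (chartAt E x₀).left_inv h
  -- A coordinate field of the chart at `x` has non-constant components in the chart at `x₀`; their
  -- derivative is the inhomogeneous term.
  have := covE_eq cov h (σ := coordField x v) hd'.differentiableAt (by
    filter_upwards [(chartAt E x).open_source.mem_nhds hx,
      (chartAt E x₀).open_source.mem_nhds h] with y hy hy'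
    rw [coordField_apply hy]
    have h1 := (chartAt E x₀).left_inv hy'
    simp only [Function.comp_apply, h1]
    have h2 := tcc_mul hy hy' (mem_chart_source E y)
    exact congr($h2.symm v))
  have := congr($this e)
  rw [hd'.fderiv, covCoord] at this
  simp only [Function.comp_apply, h0] at this
  exact this

end Christoffel

/-! ### The torsion at the centre of a chart. -/

section TorsionCenter
variable {E : Type*} [NormedAddCommGroup E] [NormedSpace ℝ E] [FiniteDimensional ℝ E]
  [CompleteSpace E]
  {M : Type*} [TopologicalSpace M] [ChartedSpace E M] [IsManifold 𝓘(ℝ, E) ∞ M]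
  (cov : CovariantDerivative 𝓘(ℝ, E) E (TangentSpace 𝓘(ℝ, E) : M → Type _))

/-- The torsion at `x`, as a bilinear map on the model space. -/
def torsionE (x : M) : E →L[ℝ] E →L[ℝ] E := cov.torsion x

/-- The torsion is evaluated on coordinate fields, whose bracket vanishes. The direction of
differentiation is the last argument of `conn`, hence the order of `v` and `w`. -/
theorem torsionE_eq (x : M) (v w : E) :
    torsionE cov x v w = TwistorSpace.conn cov x w v - TwistorSpace.conn cov x v w := by
  have h := cov.isCovariantDerivativeOnUniv.torsion_apply_eq_extend (x := x) v w
  have hb : (VectorField.mlieBracket 𝓘(ℝ, E) (coordField x v) (coordField x w) x : E) = 0 := by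
    have ht := (chartAt E x).open_target.mem_nhds (mem_chart_target E x)
    rw [mlieBracket_eq_lieBracket (v := fun _ => v) (w := fun _ => w)
      (by filter_upwards [ht] with y hy using extend_chart_symm hy v)
      (by filter_upwards [ht] with y hy using extend_chart_symm hy w)]
    simp only [VectorField.lieBracket, fderiv_fun_const, Pi.zero_apply, zero_apply, sub_zero]
    rfl
  refine h.trans ?_
  refine (congrArg (fun z : E => TwistorSpace.conn cov x w v - TwistorSpace.conn cov x v w - z)
    hb).trans (sub_zero _)

end TorsionCenter
end Twistor

namespace Twistor

/-! ### The almost complex structure `J^∇` in a full chart of `J(M)`. -/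

section Transformation
variable {E : Type*} [NormedAddCommGroup E] [NormedSpace ℝ E] [FiniteDimensional ℝ E]
  {M : Type*} [TopologicalSpace M] [ChartedSpace E M] [IsManifold 𝓘(ℝ, E) ∞ M]

namespace TwistorSpace

/-- The tautological complex structure in terms of the coordinates of the chart at `p`. -/
def strCoord (p : TwistorSpace E M) (y : TwistorModel E) : E →L[ℝ] E :=
  p.unframe (icay (stdJ E) (y.2 : E →L[ℝ] E))

/-- The change of coordinates of tangent vectors from the chart at `p` to the preferred chart at the
point with coordinates `y`. -/
def toPoint (p : TwistorSpace E M) (y : TwistorModel E) : TwistorModel E →L[ℝ] TwistorModel E :=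
  tangentCoordChange 𝓘(ℝ, TwistorModel E) p (p.chartInv y) (p.chartInv y)

theorem chartInv_mem_source {p : TwistorSpace E M} {y : TwistorModel E} (hy : y ∈ p.chart.target) :
    p.chartInv y ∈ (chartAt (TwistorModel E) p).source :=
  p.chart.map_target hy

theorem chart_chartInv {p : TwistorSpace E M} {y : TwistorModel E} (hy : y ∈ p.chart.target) :
    p.chart (p.chartInv y) = y :=
  p.chart.right_inv hy

theorem chartInv_pt' {p : TwistorSpace E M} {y : TwistorModel E} (hy : y ∈ p.chart.target) :
    (p.chartInv y).pt = (chartAt E p.pt).symm y.1 :=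
  chartInv_pt hy

theorem chartInv_pt_mem {p : TwistorSpace E M} {y : TwistorModel E} (hy : y ∈ p.chart.target) :
    (p.chartInv y).pt ∈ (chartAt E p.pt).source :=
  (chartInv_mem_source hy).1

theorem chartAt_chartInv_pt {p : TwistorSpace E M} {y : TwistorModel E} (hy : y ∈ p.chart.target) :
    chartAt E p.pt (p.chartInv y).pt = y.1 := by
  rw [chartInv_pt' hy, (chartAt E p.pt).right_inv hy.1]

theorem isOpen_chart_target (p : TwistorSpace E M) : IsOpen p.chart.target :=
  (chartAt (TwistorModel E) p).open_target

theorem hasFDerivAt_chart_chartInv {p : TwistorSpace E M} {y : TwistorModel E}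
    (hy : y ∈ p.chart.target) :
    HasFDerivAt (fun z => (p.chartInv y).chart (p.chartInv z)) (p.toPoint y) y := by
  have h := hasFDerivAt_trans (E := TwistorModel E) (chartInv_mem_source hy)
    (_root_.mem_chart_source (TwistorModel E) (p.chartInv y))
  have e : chartAt (TwistorModel E) p (p.chartInv y) = y := chart_chartInv hy
  rw [e] at h
  exact h

theorem eventually_mem_source {p : TwistorSpace E M} {y : TwistorModel E}
    (hy : y ∈ p.chart.target) :
    ∀ᶠ z in 𝓝 y, p.chartInv z ∈ (p.chartInv y).chart.source := by
  have h : ContinuousAt (chartAt (TwistorModel E) p).symm y :=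
    (chartAt (TwistorModel E) p).continuousAt_symm hy
  exact h.preimage_mem_nhds ((chartAt (TwistorModel E) (p.chartInv y)).open_source.mem_nhds
    (_root_.mem_chart_source (TwistorModel E) (p.chartInv y)))

/-- The base component of a transition map of `J(M)` is a transition map of `M` and does not involve
the fibre coordinate. -/
theorem toPoint_fst {p : TwistorSpace E M} {y : TwistorModel E} (hy : y ∈ p.chart.target)
    (u : TwistorModel E) :
    (p.toPoint y u).1 =
      tangentCoordChange 𝓘(ℝ, E) p.pt (p.chartInv y).pt (p.chartInv y).pt u.1 := by
  have h1 : HasFDerivAt (fun z => ((p.chartInv y).chart (p.chartInv z)).1)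
      ((ContinuousLinearMap.fst ℝ E (antiEnd E)).comp (p.toPoint y)) y :=
    (ContinuousLinearMap.fst ℝ E (antiEnd E)).hasFDerivAt.comp y (hasFDerivAt_chart_chartInv hy)
  have h2 := hasFDerivAt_trans (chartInv_pt_mem hy)
    (_root_.mem_chart_source E (p.chartInv y).pt)
  rw [chartAt_chartInv_pt hy] at h2
  have h3 : HasFDerivAt (fun z : TwistorModel E =>
      chartAt E (p.chartInv y).pt ((chartAt E p.pt).symm z.1))
      (ContinuousLinearMap.comp
        (tangentCoordChange 𝓘(ℝ, E) p.pt (p.chartInv y).pt (p.chartInv y).pt)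
        (ContinuousLinearMap.fst ℝ E (antiEnd E))) y :=
    h2.comp y (ContinuousLinearMap.fst ℝ E (antiEnd E)).hasFDerivAt
  have h4 := h3.unique (h1.congr_of_eventuallyEq (by
    filter_upwards [p.isOpen_chart_target.mem_nhds hy] with z hz
    rw [← chartInv_pt' hz]
    rfl))
  exact congr($h4.symm u)

/-- `fibreLin` is the derivative of the tautological structure only at the centre of a chart. At the
point with coordinates `y`, one passes through the chart centred at that point and uses the chain
rule. -/
theorem hasFDerivAt_coord_chartInv {p : TwistorSpace E M} {y : TwistorModel E}
    (hy : y ∈ p.chart.target) :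
    HasFDerivAt (fun z => (p.chartInv z).coord (p.chartInv y).pt)
      (((p.chartInv y).fibreLin.comp (ContinuousLinearMap.snd ℝ E (antiEnd E))).comp
        (p.toPoint y)) y := by
  have h := (hasFDerivAt_coord (p.chartInv y)).comp y (hasFDerivAt_chart_chartInv hy)
  refine h.congr_of_eventuallyEq ?_
  filter_upwards [eventually_mem_source hy] with z hz
  have h1 : (p.chartInv y).chartInv ((p.chartInv y).chart (p.chartInv z)) = p.chartInv z :=
    (p.chartInv y).chart.left_inv hz
  have h2 := coord_chartInv ((p.chartInv y).chart.map_source hz)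
  change ((p.chartInv y).chartInv ((p.chartInv y).chart (p.chartInv z))).coord _ = _ at h2
  rw [h1] at h2
  exact h2

/-- Both matrices represent the same endomorphism of the tangent space at `r.pt`, so the coordinate
change conjugates one into the other. -/
theorem coord_intertwine {x₀ x : M} {r : TwistorSpace E M} (h₀ : r.pt ∈ (chartAt E x₀).source)
    (h : r.pt ∈ (chartAt E x).source) :
    tangentCoordChange 𝓘(ℝ, E) x x₀ r.pt * r.coord x =
      r.coord x₀ * tangentCoordChange 𝓘(ℝ, E) x x₀ r.pt := by
  have hr := _root_.mem_chart_source E r.pt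
  rw [coord, coord, toCoord, toCoord, mul_assoc _ _ (tangentCoordChange 𝓘(ℝ, E) x x₀ r.pt),
    tcc_mul h h₀ hr, ← mul_assoc, ← mul_assoc, tcc_mul hr h h₀]

theorem contDiffAt_strCoord {p : TwistorSpace E M} {y : TwistorModel E} (hy : y ∈ p.chart.target) :
    ContDiffAt ℝ ∞ p.strCoord y := by
  have h := (contDiffAt_icay hy.2 (stdJ E)).comp y (f := fun y : TwistorModel E => (y.2 : E →L[ℝ] E))
      ((contDiff_coe (E := E)).comp contDiff_snd).contDiffAt
  exact (contDiffAt_const.mul h).mul contDiffAt_const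

theorem tcc_mul_strE {p : TwistorSpace E M} {y : TwistorModel E} (hy : y ∈ p.chart.target) :
    tangentCoordChange 𝓘(ℝ, E) (p.chartInv y).pt p.pt (p.chartInv y).pt * (p.chartInv y).strE =
      p.strCoord y * tangentCoordChange 𝓘(ℝ, E) (p.chartInv y).pt p.pt (p.chartInv y).pt := by
  have h := coord_intertwine (chartInv_pt_mem hy) (_root_.mem_chart_source E (p.chartInv y).pt)
  rw [coord_self, coord_chartInv hy] at h
  exact h

variable (cov : CovariantDerivative 𝓘(ℝ, E) E (TangentSpace 𝓘(ℝ, E) : M → Type _))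

/-- The covariant differential of the tautological structure at the point with coordinates `y`,
in terms of the coordinates of the chart at `p`. -/
def nablaCoord (p : TwistorSpace E M) (y u : TwistorModel E) : E →L[ℝ] E :=
  fderiv ℝ p.strCoord y u +
    ((christoffel cov p.pt ((chartAt E p.pt).symm y.1)).flip u.1 * p.strCoord y -
      p.strCoord y * (christoffel cov p.pt ((chartAt E p.pt).symm y.1)).flip u.1)

/-- This is the tensoriality of `π^*∇ 𝒥`. With `G` the coordinate change, differentiate the relation
`G k' = k G` between the two matrices of the tautological structure and insert the transformation
law of the connection form; the derivatives of `G` cancel. -/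
theorem nablaJE_toPoint {p : TwistorSpace E M} {y : TwistorModel E} (hy : y ∈ p.chart.target)
    (u : TwistorModel E) :
    tangentCoordChange 𝓘(ℝ, E) (p.chartInv y).pt p.pt (p.chartInv y).pt *
        nablaJE cov (p.chartInv y) (p.toPoint y u) =
      nablaCoord cov p y u *
        tangentCoordChange 𝓘(ℝ, E) (p.chartInv y).pt p.pt (p.chartInv y).pt := by
  have hx := chartInv_pt_mem hy
  have hpt := chartInv_pt' hy
  set q := p.chartInv y with hq
  set G := tangentCoordChange 𝓘(ℝ, E) q.pt p.pt q.pt with hG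
  have hb := ((contDiffAt_tcc_symm hx).differentiableAt (by simp)).hasFDerivAt
  rw [chartAt_chartInv_pt hy] at hb
  have hB : HasFDerivAt (fun z : TwistorModel E =>
      tangentCoordChange 𝓘(ℝ, E) q.pt p.pt ((chartAt E p.pt).symm z.1)) _ y :=
    hb.comp y (ContinuousLinearMap.fst ℝ E (antiEnd E)).hasFDerivAt
  have hj := ((contDiffAt_strCoord hy).differentiableAt (by simp)).hasFDerivAt
  have hL := hB.mul' (hasFDerivAt_coord_chartInv hy)
  have hR := hj.mul' hB
  -- The intertwining relation holds on a neighbourhood of `y`, so its two sides have the same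
  -- derivative.
  have hLR : ∀ᶠ z in 𝓝 y, tangentCoordChange 𝓘(ℝ, E) q.pt p.pt ((chartAt E p.pt).symm z.1) *
      (p.chartInv z).coord q.pt = p.strCoord z *
      tangentCoordChange 𝓘(ℝ, E) q.pt p.pt ((chartAt E p.pt).symm z.1) := by
    filter_upwards [eventually_mem_source hy, p.isOpen_chart_target.mem_nhds hy] with z hz hz'
    rw [← chartInv_pt' hz', strCoord, ← coord_chartInv hz']
    exact coord_intertwine (chartInv_pt_mem hz') hz.1
  have hD := congr($(hL.unique (hR.congr_of_eventuallyEq hLR)) u)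
  have hcs : q.coord q.pt = q.strE := q.coord_self
  simp only [add_apply, smul_apply, ContinuousLinearMap.comp_apply, smul_eq_mul,
    MulOpposite.smul_eq_mul_unop, MulOpposite.unop_op, ContinuousLinearMap.coe_fst',
    ContinuousLinearMap.coe_snd', ← hpt, ← hq, hcs] at hD
  -- The transformation law of the connection form, in the direction of the base component of `u`.
  have hC : G * (conn cov q.pt).flip (p.toPoint y u).1 =
      fderiv ℝ (fun z => tangentCoordChange 𝓘(ℝ, E) q.pt p.pt ((chartAt E p.pt).symm z)) y.1 u.1 +
      (christoffel cov p.pt q.pt).flip u.1 * G := by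
    ext v
    have := conn_eq_christoffel cov hx v u.1
    rw [chartAt_chartInv_pt hy] at this
    rw [toPoint_fst hy]
    exact this
  have hk : G * q.strE = p.strCoord y * G := tcc_mul_strE hy
  rw [nablaJE, nablaCoord, ← hpt, mul_add, mul_sub, ← mul_assoc G, hC, ← mul_assoc G, hk,
    mul_assoc (p.strCoord y), hC]
  have hD' : G * q.fibreLin (p.toPoint y u).2 = p.strCoord y *
      fderiv ℝ (fun z => tangentCoordChange 𝓘(ℝ, E) q.pt p.pt ((chartAt E p.pt).symm z)) y.1 u.1 +
      fderiv ℝ p.strCoord y u * G -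
      fderiv ℝ (fun z => tangentCoordChange 𝓘(ℝ, E) q.pt p.pt ((chartAt E p.pt).symm z)) y.1 u.1 *
        q.strE := by
    rw [eq_sub_iff_add_eq]
    exact hD
  rw [hD', add_mul _ _ q.strE, mul_assoc _ G, hk]
  noncomm_ring

/-- The fibre coordinate in the chart at `p` as a function of the complex structure. -/
def fibreCoord (p : TwistorSpace E M) (k : E →L[ℝ] E) : E →L[ℝ] E :=
  cay (stdJ E) (↑p.frame⁻¹ * k * p.frame)

theorem frame_conj_strCoord (p : TwistorSpace E M) (y : TwistorModel E) :
    (↑p.frame⁻¹ * p.strCoord y * p.frame : E →L[ℝ] E) = icay (stdJ E) y.2 := by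
  simp [strCoord, unframe, mul_assoc]

theorem fibreCoord_strCoord {p : TwistorSpace E M} {y : TwistorModel E} (hy : y ∈ p.chart.target) :
    p.fibreCoord (p.strCoord y) = y.2 := by
  rw [fibreCoord, frame_conj_strCoord, cay_icay p.stdJ_sq' y.2.2 hy.2]

theorem contDiffAt_fibreCoord {p : TwistorSpace E M} {y : TwistorModel E}
    (hy : y ∈ p.chart.target) : ContDiffAt ℝ ∞ p.fibreCoord (p.strCoord y) := by
  have hu := isUnit_icay_add p.stdJ_sq' y.2.2 hy.2
  rw [← p.frame_conj_strCoord y] at hu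
  refine (contDiffAt_cay hu).comp (p.strCoord y)
    (f := fun k : E →L[ℝ] E => ↑p.frame⁻¹ * k * p.frame) ?_
  exact (contDiffAt_const.mul contDiffAt_id).mul contDiffAt_const

/-- The chain rule for `fibreCoord ∘ strCoord`, which is the fibre coordinate. It recovers the
vertical part of a vector from the derivative of the tautological structure along it; `antiProj`
only brings the result back into the subtype. -/
theorem fderiv_fibreCoord {p : TwistorSpace E M} {y : TwistorModel E}
    (hy : y ∈ p.chart.target) (u : TwistorModel E) :
    antiProj E (fderiv ℝ p.fibreCoord (p.strCoord y) (fderiv ℝ p.strCoord y u)) = u.2 := by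
  have h1 := ((contDiffAt_fibreCoord hy).differentiableAt (by simp)).hasFDerivAt.comp y
    ((contDiffAt_strCoord hy).differentiableAt (by simp)).hasFDerivAt
  have h2 : HasFDerivAt (fun z : TwistorModel E => (z.2 : E →L[ℝ] E))
      ((antiEnd E).subtypeL.comp (ContinuousLinearMap.snd ℝ E (antiEnd E))) y :=
    ((antiEnd E).subtypeL.comp (ContinuousLinearMap.snd ℝ E (antiEnd E))).hasFDerivAt
  have h3 := h1.unique (h2.congr_of_eventuallyEq (by
    filter_upwards [p.isOpen_chart_target.mem_nhds hy] with z hz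
    exact fibreCoord_strCoord hz))
  have h4 : fderiv ℝ p.fibreCoord (p.strCoord y) (fderiv ℝ p.strCoord y u) = u.2 := congr($h3 u)
  rw [h4]
  exact Subtype.ext (antiProj_coe p.stdJ_sq' u.2.2)

/-- The almost complex structure `J^∇` in the coordinates of the chart at `p`. -/
def coordJ (p : TwistorSpace E M) (u y : TwistorModel E) : TwistorModel E :=
  (p.strCoord y u.1, antiProj E (fderiv ℝ p.fibreCoord (p.strCoord y)
    (p.strCoord y * nablaCoord cov p y u -
      ((christoffel cov p.pt ((chartAt E p.pt).symm y.1)).flip (p.strCoord y u.1) * p.strCoord y -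
      p.strCoord y * (christoffel cov p.pt ((chartAt E p.pt).symm y.1)).flip (p.strCoord y u.1)))))

/-- Since `toPoint` is invertible, the value of `J` comes from a unique coordinate vector `w`.
Writing `k` for `p.strCoord y`, the two defining conditions become `w.1 = k u.1` and `nablaCoord w =
k * nablaCoord u`. The second gives the derivative of `strCoord` along `w`, hence `w.2` by
`fderiv_fibreCoord`. -/
theorem isTwistorStructure_toPoint
    {J : (p : TwistorSpace E M) → TwistorModel E →L[ℝ] TwistorModel E}
    (hJ : IsTwistorStructure cov J) {p : TwistorSpace E M} {y : TwistorModel E}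
    (hy : y ∈ p.chart.target) (u : TwistorModel E) :
    J (p.chartInv y) (p.toPoint y u) = p.toPoint y (coordJ cov p u y) := by
  obtain ⟨h1, h2⟩ := (isTwistorStructure_iff cov J).1 hJ (p.chartInv y) (p.toPoint y u)
  have hinv := tcc_apply_symm (E := TwistorModel E) (chartInv_mem_source hy)
  obtain ⟨w, hw⟩ : ∃ w, J (p.chartInv y) (p.toPoint y u) = p.toPoint y w :=
    ⟨tangentCoordChange 𝓘(ℝ, TwistorModel E) (p.chartInv y) p (p.chartInv y)
      (J (p.chartInv y) (p.toPoint y u)), (hinv _).symm⟩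
  rw [hw] at h1 h2 ⊢
  congr 1
  have hx := chartInv_pt_mem hy
  have hk := tcc_mul_strE hy
  have hw1 : w.1 = p.strCoord y u.1 := by
    rw [toPoint_fst hy, toPoint_fst hy] at h1
    have h3 := congrArg (tangentCoordChange 𝓘(ℝ, E) (p.chartInv y).pt p.pt (p.chartInv y).pt) h1
    rw [tcc_symm_apply hx] at h3
    refine h3.trans ((congr($hk _)).trans ?_)
    exact congrArg (p.strCoord y) (tcc_symm_apply hx u.1)
  have hw2 : nablaCoord cov p y w = p.strCoord y * nablaCoord cov p y u := by
    have h3 := congrArg (fun z => tangentCoordChange 𝓘(ℝ, E) (p.chartInv y).pt p.pt (p.chartInv y).pt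
      * z * tangentCoordChange 𝓘(ℝ, E) p.pt (p.chartInv y).pt (p.chartInv y).pt) h2
    rw [← mul_assoc _ (p.chartInv y).strE, hk, mul_assoc (p.strCoord y), nablaJE_toPoint cov hy,
      nablaJE_toPoint cov hy, ← mul_assoc (p.strCoord y), mul_assoc, mul_assoc (_ * _),
      tcc_mul_symm hx, mul_one, mul_one] at h3
    exact h3
  refine Prod.ext hw1 ?_
  rw [← fderiv_fibreCoord hy w]
  refine congrArg (fun k => antiProj E (fderiv ℝ p.fibreCoord (p.strCoord y) k)) ?_
  rw [← hw2, nablaCoord, hw1]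
  exact (add_sub_cancel_right _ _).symm

end TwistorSpace
end Transformation
end Twistor

namespace Twistor

/-! ### The horizontal part of the Nijenhuis tensor. -/

section Nijenhuis
variable {E : Type*} [NormedAddCommGroup E] [NormedSpace ℝ E] [FiniteDimensional ℝ E]
  {M : Type*} [TopologicalSpace M] [ChartedSpace E M] [IsManifold 𝓘(ℝ, E) ∞ M]
  (cov : CovariantDerivative 𝓘(ℝ, E) E (TangentSpace 𝓘(ℝ, E) : M → Type _))

theorem fderiv_fst_apply {F G H : Type*} [NormedAddCommGroup F] [NormedSpace ℝ F]
    [NormedAddCommGroup G] [NormedSpace ℝ G] [NormedAddCommGroup H] [NormedSpace ℝ H]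
    {f : F → G × H} {x : F} (hf : DifferentiableAt ℝ f x) (v : F) :
    (fderiv ℝ f x v).1 = fderiv ℝ (fun y => (f y).1) x v := by
  have h : HasFDerivAt (fun y => (f y).1) ((ContinuousLinearMap.fst ℝ G H).comp (fderiv ℝ f x)) x :=
    (ContinuousLinearMap.fst ℝ G H).hasFDerivAt.comp x hf.hasFDerivAt
  rw [h.fderiv]
  rfl

namespace TwistorSpace

theorem mem_target_self (p : TwistorSpace E M) : p.chart p ∈ p.chart.target :=
  p.chart.map_source p.mem_chart_source

theorem chartInv_chart (p : TwistorSpace E M) : p.chartInv (p.chart p) = p :=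
  p.chart.left_inv p.mem_chart_source

theorem strCoord_self (p : TwistorSpace E M) : p.strCoord (p.chart p) = p.strE := by
  rw [strCoord, ← coord_chartInv p.mem_target_self, chartInv_chart, coord_self]

theorem hasFDerivAt_strCoord_self (p : TwistorSpace E M) :
    HasFDerivAt p.strCoord (p.fibreLin.comp (ContinuousLinearMap.snd ℝ E (antiEnd E))) (p.chart p) :=
  hasFDerivAt_coord p

theorem toPoint_self (p : TwistorSpace E M) (u : TwistorModel E) : p.toPoint (p.chart p) u = u := by
  have h := tcc_self (E := TwistorModel E) (_root_.mem_chart_source (TwistorModel E) p)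
  rw [toPoint, chartInv_chart]
  exact congr($h u)

/-- The vertical component is never differentiated explicitly, but its differentiability is needed
to read off the horizontal component of the derivative of the pair. -/
theorem differentiableAt_coordJ (p : TwistorSpace E M)
    (hΓ : ContDiffAt ℝ ∞ (fun e => christoffel cov p.pt ((chartAt E p.pt).symm e))
      (chartAt E p.pt p.pt)) (u : TwistorModel E) :
    DifferentiableAt ℝ (coordJ cov p u) (p.chart p) := by
  have hy := p.mem_target_self
  have hj := contDiffAt_strCoord hy
  have hdj := hj.fderiv_right (m := ∞) (by simp)
  have hdj' := hdj.clm_apply (contDiffAt_const (c := u))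
  have hdK := (contDiffAt_fibreCoord hy).fderiv_right (m := ∞) (by simp)
  have hdK' := hdK.comp (p.chart p) hj
  have hG := ContDiffAt.comp (p.chart p) (f := fun y : TwistorModel E => y.1) hΓ contDiffAt_fst
  have hGf := (ContinuousLinearMap.flipₗᵢ ℝ E E E).toContinuousLinearEquiv.contDiff.contDiffAt.comp
    (p.chart p) hG
  have hG1 := hGf.clm_apply (contDiffAt_const (c := u.1))
  have hj2 := hj.clm_apply (contDiffAt_const (c := u.1))
  have hG2 := hGf.clm_apply hj2
  have hn := hdj'.add ((hG1.mul hj).sub (hj.mul hG1))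
  have hm := (hj.mul hn).sub ((hG2.mul hj).sub (hj.mul hG2))
  have hm' := hdK'.clm_apply hm
  have ha := (contDiff_antiProj (E := E)).contDiffAt.comp (p.chart p) hm'
  have hr := hj2.prodMk ha
  exact hr.differentiableAt (by simp)

/-- The horizontal component of `coordJ` is the tautological structure applied to the fixed vector
`u.1`; the connection form does not occur in it. -/
theorem fderiv_coordJ_fst (p : TwistorSpace E M)
    (hΓ : ContDiffAt ℝ ∞ (fun e => christoffel cov p.pt ((chartAt E p.pt).symm e))
      (chartAt E p.pt p.pt)) (u v : TwistorModel E) :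
    (fderiv ℝ (coordJ cov p u) (p.chart p) v).1 = p.fibreLin v.2 u.1 := by
  have h2 := (ContinuousLinearMap.apply ℝ E u.1).hasFDerivAt.comp (p.chart p)
    (hasFDerivAt_strCoord_self p)
  have h3 := fderiv_fst_apply (F := E × antiEnd E) (G := E) (H := antiEnd E) (f := coordJ cov p u)
    (x := p.chart p) (differentiableAt_coordJ cov p hΓ u) v
  exact h3.trans congr($(h2.fderiv) v)

theorem coordJ_self (p : TwistorSpace E M) (u : TwistorModel E) :
    (twistorJ cov p u : TwistorModel E) = coordJ cov p u (p.chart p) := by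
  have aux : ∀ J : (p : TwistorSpace E M) → TwistorModel E →L[ℝ] TwistorModel E,
      IsTwistorStructure cov J → J p u = coordJ cov p u (p.chart p) := by
    intro J hJ
    have h := isTwistorStructure_toPoint cov hJ p.mem_target_self u
    rw [toPoint_self, toPoint_self, chartInv_chart] at h
    exact h
  exact aux _ (twistorJ_spec cov)

theorem twistorJ_coordField {p : TwistorSpace E M} {y : TwistorModel E}
    (hy : y ∈ p.chart.target) (u : TwistorModel E) :
    twistorJ cov (p.chartInv y) (coordField p u (p.chartInv y)) =
      p.toPoint y (coordJ cov p u y) := by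
  have h := coordField_apply (E := TwistorModel E) (chartInv_mem_source hy)
  exact (congrArg (twistorJ cov (p.chartInv y)) (h u)).trans
    (isTwistorStructure_toPoint cov (twistorJ_spec cov) hy u)

theorem mlieBracket_eq_lieBracket {p : TwistorSpace E M}
    {V W : (q : TwistorSpace E M) → TangentSpace 𝓘(ℝ, TwistorModel E) q}
    {v w : TwistorModel E → TwistorModel E}
    (hV : ∀ y ∈ p.chart.target, V (p.chartInv y) = p.toPoint y (v y))
    (hW : ∀ y ∈ p.chart.target, W (p.chartInv y) = p.toPoint y (w y)) :
    (VectorField.mlieBracket 𝓘(ℝ, TwistorModel E) V W p : TwistorModel E) =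
      VectorField.lieBracket ℝ v w (p.chart p) := by
  have ht := p.isOpen_chart_target.mem_nhds p.mem_target_self
  exact @Twistor.mlieBracket_eq_lieBracket (TwistorModel E) _ _ _ (TwistorSpace E M) _ _ _ p V W v w
    (Filter.mem_of_superset ht hV) (Filter.mem_of_superset ht hW)

/-- The horizontal part of the Nijenhuis tensor of `J^∇` is the `(0,2)`-part of the torsion. -/
theorem nijenhuis_fst (p : TwistorSpace E M)
    (hΓ : ContDiffAt ℝ ∞ (fun e => christoffel cov p.pt ((chartAt E p.pt).symm e))
      (chartAt E p.pt p.pt)) (u v : TwistorModel E) :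
    (show TwistorModel E from
      nijenhuis (twistorJ cov) (coordField p u) (coordField p v) p).1 =
    -(conn cov p.pt (p.strE v.1) (p.strE u.1) - conn cov p.pt (p.strE u.1) (p.strE v.1)
      - p.strE (conn cov p.pt v.1 (p.strE u.1) - conn cov p.pt (p.strE u.1) v.1)
      - p.strE (conn cov p.pt (p.strE v.1) u.1 - conn cov p.pt u.1 (p.strE v.1))
      - (conn cov p.pt v.1 u.1 - conn cov p.pt u.1 v.1)) := by
  have hX : ∀ u : TwistorModel E, ∀ y ∈ p.chart.target,
      coordField p u (p.chartInv y) = p.toPoint y u := fun u y hy => by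
    have h := coordField_apply (E := TwistorModel E) (chartInv_mem_source hy)
    exact h u
  have hJX : ∀ u : TwistorModel E, ∀ y ∈ p.chart.target,
      twistorJ cov (p.chartInv y) (coordField p u (p.chartInv y)) =
      p.toPoint y (coordJ cov p u y) := fun u y hy => twistorJ_coordField cov hy u
  have b1 := mlieBracket_eq_lieBracket (V := fun q => twistorJ cov q (coordField p u q))
    (W := fun q => twistorJ cov q (coordField p v q)) (hJX u) (hJX v)
  have b2 := mlieBracket_eq_lieBracket (V := fun q => twistorJ cov q (coordField p u q))
    (w := fun _ => v) (hJX u) (hX v)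
  have b3 := mlieBracket_eq_lieBracket (v := fun _ => u)
    (W := fun q => twistorJ cov q (coordField p v q)) (hX u) (hJX v)
  have b4 := mlieBracket_eq_lieBracket (v := fun _ => u) (w := fun _ => v) (hX u) (hX v)
  -- The fields `X` and `Y` have constant components, so only derivatives of `coordJ` survive and
  -- `[X, Y] = 0`.
  simp only [VectorField.lieBracket, fderiv_fun_const, Pi.zero_apply, zero_apply, sub_zero, zero_sub] at b1 b2 b3 b4
  have hJ1 : ∀ w : TwistorModel E, (show TwistorModel E from twistorJ cov p w).1 = p.strE w.1 :=
    fun w => by rw [coordJ_self, coordJ, strCoord_self]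
  have hN : (show TwistorModel E from
      nijenhuis (twistorJ cov) (coordField p u) (coordField p v) p).1 =
      (p.fibreLin (coordJ cov p u (p.chart p)).2 v.1 - p.fibreLin (coordJ cov p v (p.chart p)).2 u.1)
      - p.strE (-p.fibreLin v.2 u.1) - p.strE (p.fibreLin u.2 v.1) - 0 := by
    have h1 := congrArg Prod.fst b1
    have h2 := (hJ1 _).trans (congrArg (fun w : TwistorModel E => p.strE w.1) b2)
    have h3 := (hJ1 _).trans (congrArg (fun w : TwistorModel E => p.strE w.1) b3)
    have h4 := congrArg Prod.fst b4
    simp only [Prod.fst_sub, Prod.fst_neg, fderiv_coordJ_fst cov p hΓ] at h1 h2 h3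
    exact congrArg₂ (· - ·) (congrArg₂ (· - ·) (congrArg₂ (· - ·) h1 h2) h3) h4
  -- The second defining condition of `J^∇` at `p`, solved for the vertical part of `J^∇ w`. After
  -- substitution the terms in `u.2` and `v.2` cancel and only the connection form remains.
  have hspec : ∀ w : TwistorModel E, p.fibreLin (coordJ cov p w (p.chart p)).2 =
      p.strE * p.fibreLin w.2 +
      p.strE * ((conn cov p.pt).flip w.1 * p.strE - p.strE * (conn cov p.pt).flip w.1) -
      ((conn cov p.pt).flip (p.strE w.1) * p.strE - p.strE * (conn cov p.pt).flip (p.strE w.1)) := by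
    intro w
    have h := ((isTwistorStructure_iff cov (twistorJ cov)).1 (twistorJ_spec cov) p w).2
    have h' : nablaJE cov p (coordJ cov p w (p.chart p)) = p.strE * nablaJE cov p w :=
      (congrArg (nablaJE cov p) (coordJ_self cov p w)).symm.trans h
    have h1 : (coordJ cov p w (p.chart p)).1 = p.strE w.1 := by rw [coordJ, strCoord_self]
    rw [nablaJE, nablaJE, h1] at h'
    rw [← mul_add, ← h']
    abel
  have hsq : ∀ z, p.strE (p.strE z) = -z := fun z => congr($(p.strE_sq) z)
  rw [hN, hspec, hspec]
  simp only [add_apply, sub_apply, mul_apply_eq_comp, ContinuousLinearMap.flip_apply, map_sub, map_neg, hsq]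
  abel

end TwistorSpace
end Nijenhuis
end Twistor

namespace Twistor

/-! ### Smoothness of the connection form. -/

section Smooth
variable {E : Type*} [NormedAddCommGroup E] [NormedSpace ℝ E] [FiniteDimensional ℝ E]
  {M : Type*} [TopologicalSpace M] [ChartedSpace E M] [IsManifold 𝓘(ℝ, E) ∞ M]

theorem inCoordinates_eq_toCoord {x₀ x : M} (h : x ∈ (chartAt E x₀).source) (S : E →L[ℝ] E) :
    ContinuousLinearMap.inCoordinates E (TangentSpace 𝓘(ℝ, E)) E (TangentSpace 𝓘(ℝ, E)) x₀ x x₀ x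
      (show TangentSpace 𝓘(ℝ, E) x →L[ℝ] TangentSpace 𝓘(ℝ, E) x from S) = toCoord x₀ x S := by
  have h1 := TangentBundle.symmL_trivializationAt_eq_core (𝕜 := ℝ) (I := 𝓘(ℝ, E)) h
  have h2 := TangentBundle.continuousLinearMapAt_trivializationAt_eq_core (𝕜 := ℝ) (I := 𝓘(ℝ, E)) h
  rw [ContinuousLinearMap.inCoordinates, h1, h2]
  rfl

/-- Smoothness of a field of endomorphisms of the tangent spaces, in coordinates. -/
theorem contMDiffAt_end_iff {x₀ : M}
    (S : (x : M) → TangentSpace 𝓘(ℝ, E) x →L[ℝ] TangentSpace 𝓘(ℝ, E) x) :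
    ContMDiffAt 𝓘(ℝ, E) (𝓘(ℝ, E).prod 𝓘(ℝ, E →L[ℝ] E)) ∞
      (fun x => (⟨x, S x⟩ : TotalSpace (E →L[ℝ] E)
        fun x : M => TangentSpace 𝓘(ℝ, E) x →L[ℝ] TangentSpace 𝓘(ℝ, E) x)) x₀ ↔
    ContMDiffAt 𝓘(ℝ, E) 𝓘(ℝ, E →L[ℝ] E) ∞ (fun x => toCoord x₀ x (S x)) x₀ := by
  rw [contMDiffAt_hom_bundle]
  have h : (fun x => ContinuousLinearMap.inCoordinates E (TangentSpace 𝓘(ℝ, E)) E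
      (TangentSpace 𝓘(ℝ, E)) x₀ x x₀ x (S x)) =ᶠ[𝓝 x₀] fun x => toCoord x₀ x (S x) := by
    filter_upwards [(chartAt E x₀).open_source.mem_nhds (mem_chart_source E x₀)] with x hx
    exact inCoordinates_eq_toCoord hx (S x)
  exact ⟨fun H => H.2.congr_of_eventuallyEq h.symm,
    fun H => ⟨contMDiffAt_id, H.congr_of_eventuallyEq h⟩⟩

variable {cov : CovariantDerivative 𝓘(ℝ, E) E (TangentSpace 𝓘(ℝ, E) : M → Type _)}

/-- `hcov` is applied to a globally smooth section, whereas a coordinate field is controlled only on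
the chart domain. A bump function equal to 1 near `x₀` cuts it off, and locality of `∇` removes the
bump again. -/
theorem contMDiffAt_covCoord_coordField [T2Space M]
    (hcov : CovariantDerivative.ContMDiffCovariantDerivative cov ∞) (x₀ : M) (v : E) :
    ContMDiffAt 𝓘(ℝ, E) 𝓘(ℝ, E →L[ℝ] E) ∞ (covCoord cov x₀ (coordField x₀ v)) x₀ := by
  obtain ⟨ρ⟩ : Nonempty (SmoothBumpFunction 𝓘(ℝ, E) x₀) := inferInstance
  have hx := mem_chart_source E x₀
  have hg : ContMDiff 𝓘(ℝ, E) (𝓘(ℝ, E).prod 𝓘(ℝ, E)) ∞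
      (fun x => (⟨x, ((ρ : M → ℝ) • coordField x₀ v) x⟩ : TangentBundle 𝓘(ℝ, E) M)) :=
    ContMDiffOn.smul_section_of_tsupport ρ.contMDiff.contMDiffOn (chartAt E x₀).open_source
      ρ.tsupport_subset_chartAt_source
      fun x hx => (contMDiffAt_coordField hx v).contMDiffWithinAt
  have h := (contMDiffAt_end_iff _).1 ((hcov.contMDiff.contMDiff (hg.contMDiffOn)).contMDiffAt
    (x := x₀) Filter.univ_mem)
  refine h.congr_of_eventuallyEq ?_
  -- Locality is used at every `x` near `x₀`, so the bump must be 1 on a neighbourhood of each such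
  -- `x`.
  filter_upwards [ρ.eventuallyEq_one.eventuallyEq_nhds,
    (chartAt E x₀).open_source.mem_nhds hx] with x hx1 hx2
  refine congrArg (toCoord x₀ x) ?_
  refine cov.isCovariantDerivativeOnUniv.congr_of_eventuallyEq
    (mdifferentiableAt_coordField hx2 v) ((hg x).mdifferentiableAt (by simp)) Filter.univ_mem ?_
  filter_upwards [hx1] with y hy
  have : ((ρ : M → ℝ) • coordField x₀ v) y = ρ y • coordField x₀ v y := rfl
  rw [this, hy, Pi.one_apply, one_smul]

theorem contMDiffAt_smulRight {F : Type*} [NormedAddCommGroup F] [NormedSpace ℝ F] (c : E →L[ℝ] ℝ)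
    {f : M → F} {x₀ : M} (hf : ContMDiffAt 𝓘(ℝ, E) 𝓘(ℝ, F) ∞ f x₀) :
    ContMDiffAt 𝓘(ℝ, E) 𝓘(ℝ, E →L[ℝ] F) ∞ (fun x => c.smulRight (f x)) x₀ :=
  (ContinuousLinearMap.smulRightL ℝ E F c).contMDiff.contMDiffAt.comp x₀ hf

/-- The connection form is a finite sum over a basis, which leaves finitely many coordinate fields.
-/
theorem contMDiffAt_christoffel [T2Space M]
    (hcov : CovariantDerivative.ContMDiffCovariantDerivative cov ∞) (x₀ : M) :
    ContMDiffAt 𝓘(ℝ, E) 𝓘(ℝ, E →L[ℝ] E →L[ℝ] E) ∞ (christoffel cov x₀) x₀ := by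
  unfold christoffel
  exact contMDiffAt_finsetSum fun i _ => contMDiffAt_smulRight _
    (contMDiffAt_covCoord_coordField hcov x₀ (Module.finBasis ℝ E i))

theorem ContMDiffAt.contDiffAt_chart_symm {F : Type*} [NormedAddCommGroup F] [NormedSpace ℝ F]
    {f : M → F} {x₀ : M} (hf : ContMDiffAt 𝓘(ℝ, E) 𝓘(ℝ, F) ∞ f x₀) :
    ContDiffAt ℝ ∞ (fun e => f ((chartAt E x₀).symm e)) (chartAt E x₀ x₀) := by
  have h := (contMDiffAt_iff.1 hf).2
  simpa [Function.comp_def] using! h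

end Smooth

/-! ### The torsion on a whole chart domain. -/

section TorsionCoord
variable {E : Type*} [NormedAddCommGroup E] [NormedSpace ℝ E] [FiniteDimensional ℝ E]
  [CompleteSpace E]
  {M : Type*} [TopologicalSpace M] [ChartedSpace E M] [IsManifold 𝓘(ℝ, E) ∞ M]

theorem mfderiv_chart {x₀ x : M} (h : x ∈ (chartAt E x₀).source) :
    mfderiv 𝓘(ℝ, E) 𝓘(ℝ, E) (chartAt E x₀) x = tangentCoordChange 𝓘(ℝ, E) x x₀ x := by
  have h1 := (mfderiv_comp_chart h (g := id) differentiableAt_id).mfderiv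
  rw [fderiv_id] at h1
  exact h1

/-- The constant vector field on the model space. -/
def constField (v : E) : (x : E) → TangentSpace 𝓘(ℝ, E) x := fun _ => v

theorem mlieBracket_constField (v w x : E) :
    VectorField.mlieBracket 𝓘(ℝ, E) (constField v) (constField w) x = 0 := by
  have h : VectorField.lieBracketWithin ℝ (fun _ : E => v) (fun _ => w) univ x = 0 := by
    simp [VectorField.lieBracket]
  rw [← VectorField.mlieBracketWithin_univ]
  exact (congrFun (VectorField.mlieBracketWithin_eq_lieBracketWithin (V := constField v)
    (W := constField w) (s := univ)) x).trans h

theorem mpullback_chart_const {x₀ x : M} (h : x ∈ (chartAt E x₀).source) (v : E) :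
    VectorField.mpullback 𝓘(ℝ, E) 𝓘(ℝ, E) (chartAt E x₀) (constField v) x = coordField x₀ v x := by
  rw [VectorField.mpullback_apply, mfderiv_chart h, coordField_apply h]
  have hinv : ContinuousLinearMap.inverse (tangentCoordChange 𝓘(ℝ, E) x x₀ x) =
      tangentCoordChange 𝓘(ℝ, E) x₀ x x :=
    ContinuousLinearMap.inverse_eq (tcc_mul_symm h) (tcc_symm_mul h)
  exact congr($hinv v)

/-- The coordinate fields of a chart commute. -/
theorem mlieBracket_coordField {x₀ x : M} (h : x ∈ (chartAt E x₀).source) (v w : E) :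
    VectorField.mlieBracket 𝓘(ℝ, E) (coordField x₀ v) (coordField x₀ w) x = 0 := by
  -- Coordinate fields are pull-backs of constant fields along the chart, and pull-back commutes
  -- with the bracket. This works at every point of the chart domain, not only at its centre.
  have hc : ∀ u : E, coordField x₀ u =ᶠ[𝓝 x]
      VectorField.mpullback 𝓘(ℝ, E) 𝓘(ℝ, E) (chartAt E x₀) (constField u) := fun u => by
    filter_upwards [(chartAt E x₀).open_source.mem_nhds h] with y hy
    exact (mpullback_chart_const hy u).symm
  rw [(hc v).mlieBracket_vectorField_eq (hc w)]
  have hm : ∀ u : E, MDifferentiableAt 𝓘(ℝ, E) (𝓘(ℝ, E).prod 𝓘(ℝ, E))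
      (fun y => (⟨y, constField u y⟩ : TangentBundle 𝓘(ℝ, E) E)) (chartAt E x₀ x) := fun u =>
    (contMDiffAt_vectorSpace_iff_contDiffAt (V := constField u) (n := ∞)
      |>.2 contDiffAt_const).mdifferentiableAt (by simp)
  have hM : IsManifold 𝓘(ℝ, E) (minSmoothness ℝ 2) M := by
    rw [minSmoothness_of_isRCLikeNormedField]
    infer_instance
  rw [← VectorField.mpullback_mlieBracket (n := ∞) (hm v) (hm w)
    (contMDiffAt_of_mem_maximalAtlas (IsManifold.chart_mem_maximalAtlas x₀) h) (by
      rw [minSmoothness_of_isRCLikeNormedField]; exact ENat.LEInfty.out)]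
  rw [VectorField.mpullback_apply, mlieBracket_constField]
  exact map_zero _

variable (cov : CovariantDerivative 𝓘(ℝ, E) E (TangentSpace 𝓘(ℝ, E) : M → Type _))

theorem covCoord_coordField {x₀ x : M} (h : x ∈ (chartAt E x₀).source) (v : E) :
    covCoord cov x₀ (coordField x₀ v) x = christoffel cov x₀ x v := by
  have := covE_eq cov h (σ := coordField x₀ v) (s := fun _ => v) (differentiableAt_const v) (by
    filter_upwards [(chartAt E x₀).open_source.mem_nhds h] with y hy
    exact coordField_apply hy v)
  rwa [fderiv_fun_const, Pi.zero_apply, zero_add] at this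

/-- The torsion in coordinates. -/
theorem torsionE_coord {x₀ x : M} (h : x ∈ (chartAt E x₀).source) (v w : E) :
    tangentCoordChange 𝓘(ℝ, E) x x₀ x (torsionE cov x (tangentCoordChange 𝓘(ℝ, E) x₀ x x v)
      (tangentCoordChange 𝓘(ℝ, E) x₀ x x w)) =
    christoffel cov x₀ x w v - christoffel cov x₀ x v w := by
  have h1 := cov.torsion_apply (mdifferentiableAt_coordField h v) (mdifferentiableAt_coordField h w)
  rw [mlieBracket_coordField h, sub_zero, coordField_apply h, coordField_apply h] at h1
  have h2 := congrArg (tangentCoordChange 𝓘(ℝ, E) x x₀ x) h1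
  refine h2.trans ?_
  rw [← covCoord_coordField cov h, ← covCoord_coordField cov h]
  exact map_sub (tangentCoordChange 𝓘(ℝ, E) x x₀ x) _ _

end TorsionCoord
end Twistor

namespace Twistor

/-! ### The torsion-free connection and the two consequences of integrability. -/

section Symmetrization
variable {E : Type*} [NormedAddCommGroup E] [NormedSpace ℝ E] [FiniteDimensional ℝ E]
  [CompleteSpace E]
  {M : Type*} [TopologicalSpace M] [ChartedSpace E M] [IsManifold 𝓘(ℝ, E) ∞ M]
  (cov : CovariantDerivative 𝓘(ℝ, E) E (TangentSpace 𝓘(ℝ, E) : M → Type _))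

theorem torsionE_antisymm (x : M) (v w : E) : torsionE cov x v w = -torsionE cov x w v :=
  cov.torsion_antisymm v w

/-- The torsion-free connection `∇_X Y - T(X, Y) / 2` with the same geodesics as `∇`. -/
def symmetrization : CovariantDerivative 𝓘(ℝ, E) E (TangentSpace 𝓘(ℝ, E) : M → Type _) :=
  cov.addOneForm fun x => (1 / 2 : ℝ) • cov.torsion x

theorem covE_symmetrization (σ : (x : M) → TangentSpace 𝓘(ℝ, E) x) (x : M) :
    covE (symmetrization cov) σ x = covE cov σ x + (1 / 2 : ℝ) • torsionE cov x (σ x) := rfl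

/-- The added form takes the section as its first argument and the direction as its second, so the
plus sign in `symmetrization` becomes a minus sign by antisymmetry of the torsion. -/
theorem symmetrization_apply (σ : (x : M) → TangentSpace 𝓘(ℝ, E) x) (x : M)
    (X : TangentSpace 𝓘(ℝ, E) x) :
    symmetrization cov σ x X = cov σ x X - (1 / 2 : ℝ) • cov.torsion x X (σ x) := by
  rw [cov.torsion_antisymm X, smul_neg, sub_neg_eq_add]
  rfl

theorem conn_symmetrization (x : M) (v e : E) :
    TwistorSpace.conn (symmetrization cov) x v e =
      TwistorSpace.conn cov x v e + (1 / 2 : ℝ) • torsionE cov x v e := by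
  have hx : coordField x v x = v := (coordField_apply (mem_chart_source E x) v).trans
    congr($(tcc_self (mem_chart_source E x)) v)
  rw [conn_eq, covE_symmetrization, hx, ← conn_eq]
  rfl

theorem torsionE_symmetrization (x : M) (v w : E) : torsionE (symmetrization cov) x v w = 0 := by
  have h := torsionE_eq cov x v w
  rw [torsionE_eq, conn_symmetrization, conn_symmetrization, torsionE_antisymm cov x w v]
  rw [add_sub_add_comm, ← h]
  module

/-- In the chart at `x₀` the correction term is half the antisymmetrized connection form applied to
the components of `σ`, which is smooth. -/
theorem contMDiffAt_covCoord_symmetrization {cov : CovariantDerivative 𝓘(ℝ, E) E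
      (TangentSpace 𝓘(ℝ, E) : M → Type _)} [T2Space M]
    (hcov : CovariantDerivative.ContMDiffCovariantDerivative cov ∞)
    {σ : (x : M) → TangentSpace 𝓘(ℝ, E) x}
    (hσ : ContMDiff 𝓘(ℝ, E) (𝓘(ℝ, E).prod 𝓘(ℝ, E)) ∞
      (fun x => (⟨x, σ x⟩ : TangentBundle 𝓘(ℝ, E) M))) (x₀ : M) :
    ContMDiffAt 𝓘(ℝ, E) 𝓘(ℝ, E →L[ℝ] E) ∞ (covCoord (symmetrization cov) x₀ σ) x₀ := by
  have h1 : ContMDiffAt 𝓘(ℝ, E) 𝓘(ℝ, E →L[ℝ] E) ∞ (covCoord cov x₀ σ) x₀ :=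
    (contMDiffAt_end_iff _).1 ((hcov.contMDiff.contMDiff hσ.contMDiffOn).contMDiffAt
      (x := x₀) Filter.univ_mem)
  let s : M → E := fun x => tangentCoordChange 𝓘(ℝ, E) x x₀ x (σ x)
  have hs : ContMDiffAt 𝓘(ℝ, E) 𝓘(ℝ, E) ∞ s x₀ :=
    ((trivializationAt E (TangentSpace 𝓘(ℝ, E)) x₀).contMDiffAt_section_iff
      (by simp)).1 (hσ x₀)
  have hΓ := contMDiffAt_christoffel hcov x₀
  have hΓ' := (ContinuousLinearMap.flipₗᵢ ℝ E E E).toContinuousLinearEquiv.contDiff.contMDiff.contMDiffAt.comp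
    x₀ hΓ
  have h2 := h1.add ((contMDiffAt_const (I := 𝓘(ℝ, E)) (I' := 𝓘(ℝ, ℝ)) (M := M) (c := (1 / 2 : ℝ))).smul ((hΓ'.sub hΓ).clm_apply hs))
  refine h2.congr_of_eventuallyEq ?_
  filter_upwards [(chartAt E x₀).open_source.mem_nhds (mem_chart_source E x₀)] with x hx
  refine ContinuousLinearMap.ext fun e => ?_
  have h3 := torsionE_coord cov hx (s x) e
  have h4 : tangentCoordChange 𝓘(ℝ, E) x₀ x x (s x) = σ x := tcc_apply_symm hx (σ x)
  rw [h4] at h3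
  have h5 : covCoord (symmetrization cov) x₀ σ x e = covCoord cov x₀ σ x e + (1 / 2 : ℝ) •
      tangentCoordChange 𝓘(ℝ, E) x x₀ x
        (torsionE cov x (σ x) (tangentCoordChange 𝓘(ℝ, E) x₀ x x e)) := by
    rw [covCoord, covCoord, toCoord, toCoord, covE_symmetrization, ← map_smul]
    exact map_add (tangentCoordChange 𝓘(ℝ, E) x x₀ x) _ _
  rw [h5, h3]
  rfl

theorem contMDiff_symmetrization {cov : CovariantDerivative 𝓘(ℝ, E) E
      (TangentSpace 𝓘(ℝ, E) : M → Type _)} [T2Space M]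
    (hcov : CovariantDerivative.ContMDiffCovariantDerivative cov ∞) :
    CovariantDerivative.ContMDiffCovariantDerivative (symmetrization cov) ∞ :=
  ⟨⟨fun hσ => ContMDiff.contMDiffOn fun x₀ => (contMDiffAt_end_iff _).2
    (contMDiffAt_covCoord_symmetrization hcov (contMDiffOn_univ.1 hσ) x₀)⟩⟩

theorem torsion_symmetrization : (symmetrization cov).torsion = 0 := by
  funext x
  refine ContinuousLinearMap.ext fun v => ContinuousLinearMap.ext fun w => ?_
  exact torsionE_symmetrization cov x v w

/-- If `J^∇` is integrable, then the `(0,2)`-part of the torsion with respect to every complex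
structure vanishes. -/
theorem torsionE_of_isIntegrable {cov : CovariantDerivative 𝓘(ℝ, E) E
      (TangentSpace 𝓘(ℝ, E) : M → Type _)} [T2Space M]
    (hcov : CovariantDerivative.ContMDiffCovariantDerivative cov ∞)
    (hint : IsIntegrable (TwistorSpace.twistorJ cov)) (p : TwistorSpace E M) (v w : E) :
    torsionE cov p.pt (p.strE v) (p.strE w) - p.strE (torsionE cov p.pt (p.strE v) w)
      - p.strE (torsionE cov p.pt v (p.strE w)) - torsionE cov p.pt v w = 0 := by
  have hΓ := ContMDiffAt.contDiffAt_chart_symm (contMDiffAt_christoffel hcov p.pt)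
  have hX := contMDiffAt_coordField (E := TwistorModel E)
    (_root_.mem_chart_source (TwistorModel E) p)
  -- The vertical components are set to 0; the horizontal part of the Nijenhuis tensor does not
  -- depend on them.
  have h := TwistorSpace.nijenhuis_fst cov p hΓ (v, 0) (w, 0)
  have h0 := hint p _ _ (hX (v, 0)) (hX (w, 0))
  have h1 := (congrArg Prod.fst h0 :
    (show TwistorModel E from nijenhuis (TwistorSpace.twistorJ cov) (coordField p (v, 0))
      (coordField p (w, 0)) p).1 = 0).symm.trans h
  have h2 := neg_eq_zero.1 h1.symm
  simp only [torsionE_eq]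
  rw [← h2]

/-- By uniqueness it suffices that the structure of `cov` satisfies the conditions for the
symmetrized connection. With `B e = T(·, e) / 2`, the covariant differential of `𝒥` along `w`
changes by the commutator of `B w.1` with `j`, so only compatibility of this commutator with `j` has
to be checked. -/
theorem twistorJ_symmetrization
    (h : ∀ (p : TwistorSpace E M) (v w : E),
      torsionE cov p.pt (p.strE v) (p.strE w) - p.strE (torsionE cov p.pt (p.strE v) w)
        - p.strE (torsionE cov p.pt v (p.strE w)) - torsionE cov p.pt v w = 0) :
    TwistorSpace.twistorJ (symmetrization cov) = TwistorSpace.twistorJ cov := by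
  refine (TwistorSpace.existsUnique_isTwistorStructure (symmetrization cov)).unique
    (TwistorSpace.twistorJ_spec _) ?_
  refine (TwistorSpace.isTwistorStructure_iff _ _).2 fun p u => ?_
  obtain ⟨h1, h2⟩ := (TwistorSpace.isTwistorStructure_iff cov _).1 (TwistorSpace.twistorJ_spec cov) p u
  refine ⟨h1, ?_⟩
  let B : E → E →L[ℝ] E := fun e => (1 / 2 : ℝ) • (torsionE cov p.pt).flip e
  have hn : ∀ w : TwistorModel E, TwistorSpace.nablaJE (symmetrization cov) p w =
      TwistorSpace.nablaJE cov p w + (B w.1 * p.strE - p.strE * B w.1) := fun w => by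
    have hB : (TwistorSpace.conn (symmetrization cov) p.pt).flip w.1 =
        (TwistorSpace.conn cov p.pt).flip w.1 + B w.1 :=
      ContinuousLinearMap.ext fun v => conn_symmetrization cov p.pt v w.1
    rw [TwistorSpace.nablaJE, TwistorSpace.nablaJE, hB]
    noncomm_ring
  -- Applied to `v` and expanded with `j² = -1`, this is half the hypothesis for the pair `v`,
  -- `u.1`.
  have hD : B (p.strE u.1) * p.strE - p.strE * B (p.strE u.1) =
      p.strE * (B u.1 * p.strE - p.strE * B u.1) := by
    refine ContinuousLinearMap.ext fun v => ?_
    have hsq : ∀ z, p.strE (p.strE z) = -z := fun z => congr($(p.strE_sq) z)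
    have := h p v u.1
    simp only [B, sub_apply, mul_apply_eq_comp, smul_apply, ContinuousLinearMap.flip_apply,
      map_smul, map_sub, hsq, ← smul_sub]
    congr 1
    rw [← sub_eq_zero, ← this]
    abel
  rw [hn, hn, h1, mul_add, ← hD]
  exact congrArg (· + _) h2

theorem torsion_eq_trace_type (hE : Even (Module.finrank ℝ E))
    (h : ∀ (p : TwistorSpace E M) (v w : E),
      torsionE cov p.pt (p.strE v) (p.strE w) - p.strE (torsionE cov p.pt (p.strE v) w)
        - p.strE (torsionE cov p.pt v (p.strE w)) - torsionE cov p.pt v w = 0)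
    (x : M) (X Y : TangentSpace 𝓘(ℝ, E) x) :
    cov.torsion x X Y = torsionTrace cov x X • Y - torsionTrace cov x Y • X := by
  let T : E →ₗ[ℝ] E →ₗ[ℝ] E :=
    LinearMap.mk₂ ℝ (fun v w => torsionE cov x v w) (by simp) (by simp) (by simp) (by simp)
  refine eq_trace_type (T := T) hE (fun v => cov.torsion_self v) (fun j hj v w => ?_) X Y
  -- Every complex structure on `T_x M` is a point of `J(M)` over `x`, so the hypothesis covers all
  -- `j`.
  exact h ⟨x, (show E →L[ℝ] E from LinearMap.toContinuousLinearMap j), hj⟩ v w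

end Symmetrization
end Twistor

end

/-! ### The main theorem. -/

theorem mainTheorem4
    {E : Type*} [NormedAddCommGroup E] [NormedSpace ℝ E] [FiniteDimensional ℝ E] [CompleteSpace E]
    (hE : Even (Module.finrank ℝ E))
    {M : Type*} [TopologicalSpace M] [T2Space M] [ChartedSpace E M] [IsManifold 𝓘(ℝ, E) ∞ M]
    (cov : CovariantDerivative 𝓘(ℝ, E) E (TangentSpace 𝓘(ℝ, E) : M → Type _))
    (hcov : CovariantDerivative.ContMDiffCovariantDerivative cov ∞)
    (hint : Twistor.IsIntegrable (Twistor.TwistorSpace.twistorJ cov)) :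
    (∀ (x : M) (X Y : TangentSpace 𝓘(ℝ, E) x),
      cov.torsion x X Y =
        Twistor.torsionTrace cov x X • Y - Twistor.torsionTrace cov x Y • X) ∧
    ∃ cov' : CovariantDerivative 𝓘(ℝ, E) E (TangentSpace 𝓘(ℝ, E) : M → Type _),
      (∀ (σ : (x : M) → TangentSpace 𝓘(ℝ, E) x) (x : M) (X : TangentSpace 𝓘(ℝ, E) x),
        cov' σ x X = cov σ x X - (1 / 2 : ℝ) • cov.torsion x X (σ x)) ∧
      CovariantDerivative.ContMDiffCovariantDerivative cov' ∞ ∧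
      cov'.torsion = 0 ∧
      Twistor.TwistorSpace.twistorJ cov' = Twistor.TwistorSpace.twistorJ cov := by
  have h := Twistor.torsionE_of_isIntegrable hcov hint
  exact ⟨Twistor.torsion_eq_trace_type cov hE h, Twistor.symmetrization cov,
    Twistor.symmetrization_apply cov, Twistor.contMDiff_symmetrization hcov,
    Twistor.torsion_symmetrization cov, Twistor.twistorJ_symmetrization cov h⟩
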